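/- Let $n\ge 2$ and $s>1/2$. Let $a$ be a real-valued function which is $C^\infty$ on $\mathbb R^n\setminus\{0\}$ and satisfies $a(\lambda\xi)=\lambda^2a(\xi)$ for all $\lambda>0$ and $\xi\neq0$. Assume that for every $\xi\ne0$ with $\nabla a(\xi)=0$ the Hessian matrix $\nabla^2a(\xi)$ has rank $n-1$. Then there is a constant $C\geq 0$ such that for all $\varphi\in L^2(\mathbb R^n)$ $$\big\|\langle x\rangle^{-s}\,|\nabla a(D_x)|^{1/2}e^{ita(D_x)}\varphi(x)\big\|_{L^2(\mathbb R_t\times\mathbb R^n_x)}\le C\,\|\varphi\|_{L^2(\mathbb R^n_x)} .$$ Here $\langle x\rangle=\sqrt{1+|x|^2}$, $D_x=-i\partial_x$, and $|\nabla a(D_x)|^{1/2}e^{ita(D_x)}\varphi$ is the tempered distribution on $\mathbb R^n$ whose Fourier transform is $|\nabla a(\xi)|^{1/2}e^{ita(\xi)}\widehat\varphi(\xi)$, with $\widehat\varphi(\xi)=\int e^{-ix\cdot\xi}\varphi(x)\,dx$; the estimate includes the claim that, for almost every $t$, this distribution is given by the slice $u(t,\cdot)$ of a measurable function $u$ on $\mathbb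 R_t\times\mathbb R^n_x$, whose weighted norm is the left-hand side. -/

import Mathlib

open MeasureTheory SchwartzMap FourierTransform
open scoped ContDiff NNReal ENNReal

noncomputable section

/-- The Hessian matrix `(∂ᵢ ∂ⱼ a (ξ))` of a function `a` on `ℝⁿ`. -/
def hessianMatrix {n : ℕ} (a : EuclideanSpace ℝ (Fin n) → ℝ) (ξ : EuclideanSpace ℝ (Fin n)) :
    Matrix (Fin n) (Fin n) ℝ :=
  Matrix.of fun i j =>
    fderiv ℝ (fun η => fderiv ℝ a η (EuclideanSpace.single j 1)) ξ (EuclideanSpace.single i 1)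

/-- The Japanese bracket `⟨x⟩ = √(1 + |x|²)`. -/
def japaneseBracket {n : ℕ} (x : EuclideanSpace ℝ (Fin n)) : ℝ :=
  Real.sqrt (1 + ‖x‖ ^ 2)

/-- The function `v` on `ℝⁿ` is `m(D)φ`, for `φ ∈ L²(ℝⁿ)` and a symbol `m`, where `D = -i∂`.

It means that, as a tempered distribution, `v` is the inverse Fourier transform of `m φ̂`:
`∫ v ψ = ∫ m φ̂ (𝓕⁻¹ψ)` for all Schwartz functions `ψ`, where both integrals converge absolutely.
Mathlib's Fourier transform has kernel `exp (-2πi x·ξ)`, so that `D` corresponds to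
multiplication by `2πξ`, and `m(D)` to multiplication by `m (2πξ)`. Since `m φ̂` need not be in
`L²`, the identity is taken in the sense of tempered distributions; it determines `v`
almost everywhere. -/
def IsFourierMultiplierImage {n : ℕ} (m : EuclideanSpace ℝ (Fin n) → ℂ)
    (φ : Lp (α := EuclideanSpace ℝ (Fin n)) ℂ 2) (v : EuclideanSpace ℝ (Fin n) → ℂ) : Prop :=
  ∀ ψ : 𝓢(EuclideanSpace ℝ (Fin n), ℂ),
    Integrable (fun x => v x * ψ x) ∧
    Integrable (fun ξ => m ((2 * Real.pi) • ξ) * (𝓕 φ) ξ * (𝓕⁻ ψ) ξ) ∧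
    ∫ x, v x * ψ x = ∫ ξ, m ((2 * Real.pi) • ξ) * (𝓕 φ) ξ * (𝓕⁻ ψ) ξ

/-- The symbol `|∇a(ξ)|^{1/2} e^{i t a(ξ)}`. -/
def invariantSymbol {n : ℕ} (a : EuclideanSpace ℝ (Fin n) → ℝ) (t : ℝ)
    (ξ : EuclideanSpace ℝ (Fin n)) : ℂ :=
  ((‖gradient a ξ‖ ^ (1 / 2 : ℝ) : ℝ) : ℂ) * Complex.exp (Complex.I * (t : ℂ) * (a ξ : ℂ))

/-- The invariant estimate
`‖⟨x⟩^{-s} |∇a(D)|^{1/2} e^{i t a(D)} φ‖_{L²(ℝ_t × ℝⁿ_x)} ≤ C ‖φ‖_{L²(ℝⁿ)}` for all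
`φ ∈ L²(ℝⁿ)`, with the constant `C`: the distribution `|∇a(D)|^{1/2} e^{i t a(D)} φ` is, for
almost every `t`, the slice `u(t, ·)` of a measurable function `u` of `(t, x)` (unique up to
null sets), which satisfies the bound. -/
def InvariantEstimate {n : ℕ} (a : EuclideanSpace ℝ (Fin n) → ℝ) (s : ℝ) (C : ℝ≥0) : Prop :=
  ∀ φ : Lp (α := EuclideanSpace ℝ (Fin n)) ℂ 2,
    ∃ u : ℝ × EuclideanSpace ℝ (Fin n) → ℂ,
      AEStronglyMeasurable u volume ∧
      (∀ᵐ t : ℝ, IsFourierMultiplierImage (invariantSymbol a t) φ (fun x => u (t, x))) ∧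
      eLpNorm (fun p : ℝ × EuclideanSpace ℝ (Fin n) =>
          ((japaneseBracket p.2 ^ (-s) : ℝ) : ℂ) * u p) 2 volume
        ≤ (C : ℝ≥0∞) * ‖φ‖ₑ

end

/-! The roles of time and of one space coordinate are exchanged. On a hyperplane `⟪e, x⟫ = r`, with
`e` a unit vector, the evolution is a function of `t` and of the remaining coordinates. As such it
is an inverse Fourier transform in the variable `straighten a e ξ`, which keeps the part of `ξ`
orthogonal to `e` and puts `a ξ` in the direction `e`; the Jacobian is the derivative `∂ₑa`. If this
map is injective on the frequency set and `|∇a| < 2 ∂ₑa` there, Plancherel bounds the squared norm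
on the hyperplane by `∫ (|∇a| / ∂ₑa) |h|² ≤ 2 ‖h‖²`, uniformly in `r`
(`exists_fourierInv_eq_evolution`). Integration against `⟨r⟩^{-2s}` gives `admissible_of_injOn`.

It remains to cover the frequencies by finitely many such sets. Given a direction `ξ₀` of `ξ` and a
direction `v` of `∇a`, choose `e` near `v` with `∂ₑa` or `∂ₑ²a` nonzero at `ξ₀`; this is possible
because `∇a` and the Hessian do not vanish together (`exists_unit_inner_gt`). By continuity and
homogeneity the sign persists in a convex cone. There the points with `∂ₑa > 0` on a line parallel
to `e` form an interval, on which `a` increases (`lt_of_fderiv_pos_of_convex`). Compactness of a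
product of two spheres leaves finitely many sets (`exists_admissible`), and critical frequencies
contribute nothing because the symbol vanishes there. Truncation to balls then reaches all of `L²`
(`exists_evolution_of_memLp`). -/

noncomputable section

/-! ### Plancherel, and the exchange of time with a space coordinate -/

open scoped RealInnerProductSpace

variable {V : Type*} [NormedAddCommGroup V] [InnerProductSpace ℝ V]

/-- For a unit vector `e`, this map exchanges the first coordinate of `ℝ × V` with the component
of the second coordinate along `e`. -/
def swapAlong (e : V) (p : ℝ × V) : ℝ × V :=
  (⟪e, p.2⟫, p.2 + (p.1 - ⟪e, p.2⟫) • e)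

theorem inner_swapAlong {e : V} (he : ‖e‖ = 1) (p : ℝ × V) : ⟪e, (swapAlong e p).2⟫ = p.1 := by
  simp [swapAlong, inner_add_right, inner_smul_right, he]

variable [FiniteDimensional ℝ V] [MeasurableSpace V] [BorelSpace V]

/-- The inverse Fourier transform of an integrable function is continuous. -/
theorem continuous_fourierInv_of_integrable {G : V → ℂ} (hG : Integrable G) :
    Continuous (𝓕⁻ G) :=
  VectorFourier.fourierIntegral_continuous (L := -innerₗ V) Real.continuous_fourierChar
    continuous_inner.neg hG

/-- The inverse Fourier transform is self-adjoint for the bilinear pairing. -/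
theorem integral_fourierInv_mul_eq {G g : V → ℂ} (hG : Integrable G) (hg : Integrable g) :
    ∫ x, 𝓕⁻ G x * g x = ∫ ξ, G ξ * 𝓕⁻ g ξ := by
  have h := VectorFourier.integral_fourierIntegral_smul_eq_flip (L := -innerₗ V)
    Real.continuous_fourierChar continuous_inner.neg hG hg
  have hflip : (-innerₗ V).flip = -innerₗ V := by
    ext x y
    simp [real_inner_comm]
  rw [hflip] at h
  exact h

/-- Plancherel's theorem for functions in `L¹ ∩ L²`. -/
theorem eLpNorm_fourierInv_eq {G : V → ℂ} (hG : Integrable G) (hG2 : MemLp G 2) :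
    eLpNorm (𝓕⁻ G) 2 = eLpNorm G 2 := by
  set g : Lp ℂ 2 (volume : Measure V) := hG2.toLp G with hg
  -- The `L²` transform and the integral agree almost everywhere, since they have the same pairing
  -- with every test function.
  have key : ∀ᵐ x, (𝓕⁻ g : Lp ℂ 2 (volume : Measure V)) x = 𝓕⁻ G x := by
    refine ae_eq_of_integral_contDiff_smul_eq
      ((Lp.memLp (𝓕⁻ g)).locallyIntegrable (by norm_num))
      (continuous_fourierInv_of_integrable hG).locallyIntegrable fun f hf hfs => ?_
    have hfc : HasCompactSupport (fun x => (f x : ℂ)) := hfs.comp_left (g := Complex.ofReal) rfl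
    set ψ : 𝓢(V, ℂ) := hfc.toSchwartzMap (Complex.ofRealCLM.contDiff.comp hf) with hψ
    have hψx : ∀ x, ψ x = (f x : ℂ) := fun x => rfl
    have h1 := congrArg (fun T : 𝓢'(V, ℂ) => T ψ) (Lp.fourierInv_toTemperedDistribution_eq g)
    simp only [TemperedDistribution.fourierInv_apply, Lp.toTemperedDistribution_apply] at h1
    calc ∫ x, f x • (𝓕⁻ g : Lp ℂ 2 (volume : Measure V)) x
        = ∫ x, ψ x • (𝓕⁻ g : Lp ℂ 2 (volume : Measure V)) x := by
          simp only [hψx, Complex.coe_smul]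
      _ = ∫ x, (𝓕⁻ ψ) x • g x := h1.symm
      _ = ∫ x, G x * 𝓕⁻ (ψ : V → ℂ) x := by
          refine integral_congr_ae ?_
          filter_upwards [hG2.coeFn_toLp] with x hx
          rw [hg, hx, smul_eq_mul, mul_comm, SchwartzMap.fourierInv_coe]
      _ = ∫ x, 𝓕⁻ G x * ψ x := (integral_fourierInv_mul_eq hG ψ.integrable).symm
      _ = ∫ x, f x • 𝓕⁻ G x := by
          simp only [hψx, mul_comm, ← smul_eq_mul, Complex.coe_smul]
  rw [← eLpNorm_congr_ae key, ← eLpNorm_congr_ae hG2.coeFn_toLp, ← hg, ← Lp.enorm_def,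
    ← Lp.enorm_def]
  have : ‖(𝓕⁻ g : Lp ℂ 2 (volume : Measure V))‖ = ‖g‖ := by
    rw [← Lp.norm_fourier_eq, fourier_fourierInv_eq]
  rw [← ofReal_norm, ← ofReal_norm, this]

/-- The exchange is a composition of shears, the middle one combined with a reflection of the real
coordinate. -/
theorem measurePreserving_swapAlong {e : V} (he : ‖e‖ = 1) :
    MeasurePreserving (swapAlong e) (volume : Measure (ℝ × V)) volume := by
  have h1 : ∀ c : ℝ, MeasurePreserving (fun p : ℝ × V => (p.1, p.2 + (c * p.1) • e))
      (volume.prod volume) (volume.prod volume) := fun c =>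
    (MeasurePreserving.id volume).skew_product (g := fun (t : ℝ) (x : V) => x + (c * t) • e)
      (by unfold Function.uncurry; fun_prop)
      (Filter.Eventually.of_forall fun t => map_add_right_eq_self _ _)
  have h2 : MeasurePreserving (fun p : V × ℝ => (p.1, ⟪e, p.1⟫ - p.2))
      (volume.prod volume) (volume.prod volume) :=
    (MeasurePreserving.id volume).skew_product (g := fun (x : V) (t : ℝ) => ⟪e, x⟫ - t)
      (by unfold Function.uncurry; fun_prop)
      (Filter.Eventually.of_forall fun x => (Measure.measurePreserving_sub_left volume _).map_eq)
  have h3 := (h1 (-1)).comp ((Measure.measurePreserving_swap.comp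
    (h2.comp Measure.measurePreserving_swap)).comp (h1 1))
  convert! h3 using 1
  funext p
  ext1
  · simp [swapAlong, inner_add_right, inner_smul_right, he]
  · simp [swapAlong, inner_add_right, inner_smul_right, he]
    module

end

/-! ### The smoothing estimate on one set of frequencies -/

noncomputable section

open scoped RealInnerProductSpace

variable {W : Type*} [NormedAddCommGroup W]

/-- The weight `⟨x⟩^{-s}`. -/
def bracketWeight (s : ℝ) (x : W) : ℝ := (1 + ‖x‖ ^ 2) ^ (-s / 2)

theorem bracketWeight_nonneg (s : ℝ) (x : W) : 0 ≤ bracketWeight s x :=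
  Real.rpow_nonneg (by positivity) _

theorem bracketWeight_pos (s : ℝ) (x : W) : 0 < bracketWeight s x :=
  Real.rpow_pos_of_pos (by positivity) _

theorem continuous_bracketWeight (s : ℝ) : Continuous (bracketWeight s : W → ℝ) := by
  unfold bracketWeight
  exact Continuous.rpow_const (by fun_prop) fun x => Or.inl (by positivity)

variable {V : Type*} [NormedAddCommGroup V] [InnerProductSpace ℝ V]

/-- By Cauchy–Schwarz, the weight may be replaced by one that is constant on the hyperplanes
orthogonal to `e`. -/
theorem bracketWeight_le_inner {s : ℝ} (hs : 0 ≤ s) {e : V} (he : ‖e‖ = 1) (x : V) :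
    bracketWeight s x ≤ bracketWeight s ⟪e, x⟫ := by
  have h : |⟪e, x⟫| ≤ ‖x‖ := by simpa [he] using abs_real_inner_le_norm e x
  refine Real.rpow_le_rpow_of_nonpos (by positivity) ?_ (by linarith)
  rw [Real.norm_eq_abs]
  gcongr

/-- The weight only has to be integrated in one dimension, so `2s > 1` suffices. -/
theorem lintegral_bracketWeight_sq_lt_top {s : ℝ} (hs : 1 / 2 < s) :
    ∫⁻ r : ℝ, ‖bracketWeight s r‖ₑ ^ 2 < ⊤ := by
  have h := (integrable_rpow_neg_one_add_norm_sq (E := ℝ) (μ := volume) (r := 2 * s)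
    (by simp; linarith)).2
  convert h using 2
  unfold HasFiniteIntegral
  refine iff_of_eq (congrArg (· < ⊤) (lintegral_congr fun r => ?_))
  rw [← enorm_pow, bracketWeight, ← Real.rpow_mul_natCast (by positivity)]
  ring_nf

/-- Replace the component of `ξ` along `e` by `a ξ`. -/
def straighten (a : V → ℝ) (e : V) (ξ : V) : V := ξ + (a ξ - ⟪e, ξ⟫) • e

theorem hasFDerivAt_straighten {a : V → ℝ} {e ξ : V} (h : DifferentiableAt ℝ a ξ) :
    HasFDerivAt (straighten a e)
      (ContinuousLinearMap.id ℝ V + (fderiv ℝ a ξ - innerSL ℝ e).smulRight e) ξ :=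
  (hasFDerivAt_id ξ).add ((h.hasFDerivAt.sub (innerSL ℝ e).hasFDerivAt).smul_const e)

/-- A rank-one perturbation of the identity has determinant `1 + (L - ⟪e, ·⟫) e`, and `⟪e, e⟫ = 1`.
-/
theorem det_straighten [FiniteDimensional ℝ V] {e : V} (he : ‖e‖ = 1) (L : V →L[ℝ] ℝ) :
    (ContinuousLinearMap.id ℝ V + (L - innerSL ℝ e).smulRight e).det = L e := by
  have h := LinearMap.transvection.det ((L - innerSL ℝ e : V →L[ℝ] ℝ) : V →ₗ[ℝ] ℝ) e
  have h2 : ((ContinuousLinearMap.id ℝ V + (L - innerSL ℝ e).smulRight e : V →L[ℝ] V) :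
      V →ₗ[ℝ] V) = LinearMap.transvection ((L - innerSL ℝ e : V →L[ℝ] ℝ) : V →ₗ[ℝ] ℝ) e := by
    ext x
    simp [LinearMap.transvection.apply]
  rw [ContinuousLinearMap.det, h2, h]
  simp [he]

theorem norm_gradient [CompleteSpace V] (a : V → ℝ) (ξ : V) : ‖gradient a ξ‖ = ‖fderiv ℝ a ξ‖ := by
  simp [gradient]

variable [FiniteDimensional ℝ V] [MeasurableSpace V] [BorelSpace V]

/-- The function `|∇a(D)|^{1/2} e^{i τ a(D)} 𝓕⁻h`, in the normalization of Mathlib's Fourier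
transform. -/
def evolution (a : V → ℝ) (h : V → ℂ) (p : ℝ × V) : ℂ :=
  𝓕⁻ (fun ξ => Real.fourierChar (p.1 * a ξ) • ((√‖gradient a ξ‖ : ℂ) * h ξ)) p.2

theorem evolution_eq_integral (a : V → ℝ) (h : V → ℂ) (p : ℝ × V) :
    evolution a h p = ∫ ξ, Real.fourierChar (⟪ξ, p.2⟫ + p.1 * a ξ) •
      ((√‖gradient a ξ‖ : ℂ) * h ξ) := by
  simp only [evolution, Real.fourierInv_eq, AddChar.map_add_eq_mul, mul_smul]

/-- The set `F` of frequencies is admissible if the smoothing estimate holds for functions with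
frequencies in `F`. -/
def Admissible (a : V → ℝ) (s : ℝ) (F : Set V) : Prop :=
  ∃ C : ℝ≥0, ∀ h : V → ℂ, MemLp h 2 → Integrable (fun ξ => (√‖gradient a ξ‖ : ℂ) * h ξ) →
    (∀ ξ ∉ F, h ξ = 0) →
    eLpNorm (fun p : ℝ × V => (bracketWeight s p.2 : ℂ) * evolution a h p) 2 ≤ C * eLpNorm h 2

theorem integrable_fourierChar_smul {α : Type*} [MeasurableSpace α] {μ : Measure α} {f : α → ℂ}
    {b : α → ℝ} (hb : Measurable b) (hf : Integrable f μ) :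
    Integrable (fun ξ => Real.fourierChar (b ξ) • f ξ) μ := by
  refine hf.mono ?_ (Filter.Eventually.of_forall fun ξ => by rw [Circle.norm_smul])
  simp only [Circle.smul_def]
  have : Measurable fun ξ => ((Real.fourierChar (b ξ) : Circle) : ℂ) :=
    (continuous_subtype_val.comp Real.continuous_fourierChar).measurable.comp hb
  exact this.aestronglyMeasurable.smul hf.1

theorem continuous_evolution {a : V → ℝ} (ha : Measurable a) {h : V → ℂ}
    (hh : Integrable (fun ξ => (√‖gradient a ξ‖ : ℂ) * h ξ)) : Continuous (evolution a h) := by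
  rw [funext (evolution_eq_integral a h)]
  refine continuous_of_dominated
    (fun p => (integrable_fourierChar_smul (by fun_prop) hh).1)
    (fun p => Filter.Eventually.of_forall fun ξ => (Circle.norm_smul _ _).le) hh.norm
    (Filter.Eventually.of_forall fun ξ => ?_)
  have : Continuous fun p : ℝ × V => Real.fourierChar (⟪ξ, p.2⟫ + p.1 * a ξ) :=
    Real.continuous_fourierChar.comp (by fun_prop)
  fun_prop

theorem evolution_add {a : V → ℝ} (ha : Measurable a) {g h : V → ℂ}
    (hg : Integrable (fun ξ => (√‖gradient a ξ‖ : ℂ) * g ξ))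
    (hh : Integrable (fun ξ => (√‖gradient a ξ‖ : ℂ) * h ξ)) (p : ℝ × V) :
    evolution a (g + h) p = evolution a g p + evolution a h p := by
  simp only [evolution_eq_integral, Pi.add_apply, mul_add, smul_add]
  exact integral_add (integrable_fourierChar_smul (by fun_prop) hg)
    (integrable_fourierChar_smul (by fun_prop) hh)

theorem eLpNorm_two_sq {α : Type*} [MeasurableSpace α] (μ : Measure α) {F : Type*}
    [NormedAddCommGroup F] (f : α → F) : eLpNorm f 2 μ ^ 2 = ∫⁻ x, ‖f x‖ₑ ^ 2 ∂μ := by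
  simpa using eLpNorm_nnreal_pow_eq_lintegral (f := f) (μ := μ) (p := 2) (by simp)

theorem eLpNorm_two_le_of_lintegral_le {α β F G : Type*} [MeasurableSpace α] [MeasurableSpace β]
    [NormedAddCommGroup F] [NormedAddCommGroup G] {μ : Measure α} {ν : Measure β} {f : α → F}
    {g : β → G} {C : ℝ≥0∞} (h : ∫⁻ x, ‖f x‖ₑ ^ 2 ∂μ ≤ C * ∫⁻ x, ‖g x‖ₑ ^ 2 ∂ν) :
    eLpNorm f 2 μ ≤ C ^ (1 / 2 : ℝ) * eLpNorm g 2 ν := by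
  rw [← eLpNorm_two_sq, ← eLpNorm_two_sq] at h
  have h2 := ENNReal.rpow_le_rpow h (z := 1 / 2) (by norm_num)
  rw [ENNReal.mul_rpow_of_nonneg _ _ (by norm_num)] at h2
  have h3 : ∀ y : ℝ≥0∞, (y ^ 2) ^ (1 / 2 : ℝ) = y := fun y => by
    rw [← ENNReal.rpow_natCast, ← ENNReal.rpow_mul]
    norm_num
  rwa [h3, h3] at h2

/-- For each `r`, there is a function `G` whose inverse Fourier transform is the restriction of
the evolution to the hyperplane where the component along `e` is `r`. -/
theorem exists_fourierInv_eq_evolution {a : V → ℝ} {e : V} (he : ‖e‖ = 1)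
    {F : Set V} (hF : MeasurableSet F) (hd : ∀ ξ ∈ F, DifferentiableAt ℝ a ξ)
    (hpos : ∀ ξ ∈ F, ‖gradient a ξ‖ < 2 * fderiv ℝ a ξ e)
    (hinj : Set.InjOn (straighten a e) F) {h : V → ℂ}
    (hh : Integrable (fun ξ => (√‖gradient a ξ‖ : ℂ) * h ξ)) (hh2 : MemLp h 2)
    (hhF : ∀ ξ ∉ F, h ξ = 0) (r : ℝ) :
    ∃ G : V → ℂ, Integrable G ∧ MemLp G 2 ∧ eLpNorm G 2 ^ 2 ≤ 2 * eLpNorm h 2 ^ 2 ∧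
      ∀ y, 𝓕⁻ G y = evolution a h (swapAlong e (r, y)) := by
  classical
  set Φ := straighten a e with hΦ
  set k : V → ℂ := fun ξ => (√‖gradient a ξ‖ : ℂ) * h ξ with hk
  set d : V → ℝ := fun ξ => fderiv ℝ a ξ e with hdd
  have hdpos : ∀ ξ ∈ F, 0 < d ξ := fun ξ hξ => by
    have := hpos ξ hξ
    have := norm_nonneg (gradient a ξ)
    simp only [hdd]; linarith
  have hf' : ∀ ξ ∈ F, HasFDerivWithinAt Φ
      (ContinuousLinearMap.id ℝ V + (fderiv ℝ a ξ - innerSL ℝ e).smulRight e) F ξ :=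
    fun ξ hξ => (hasFDerivAt_straighten (hd ξ hξ)).hasFDerivWithinAt
  have hdet : ∀ ξ ∈ F, |(ContinuousLinearMap.id ℝ V +
      (fderiv ℝ a ξ - innerSL ℝ e).smulRight e).det| = d ξ := fun ξ hξ => by
    rw [det_straighten he, abs_of_pos (hdpos ξ hξ)]
  have hΦF : MeasurableSet (Φ '' F) := measurable_image_of_fderivWithin hF hf' hinj
  -- The density is divided by the Jacobian of the change of variables. The position `r` of the
  -- hyperplane enters only through a unimodular factor, invisible to the `L²` norm.
  set H : V → ℂ := fun η =>
    Real.fourierChar (r * ⟪e, Function.invFunOn Φ F η⟫) •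
      ((d (Function.invFunOn Φ F η))⁻¹ • k (Function.invFunOn Φ F η)) with hH
  have hinv : ∀ ξ ∈ F, Function.invFunOn Φ F (Φ ξ) = ξ := fun ξ hξ =>
    hinj.leftInvOn_invFunOn hξ
  have hHΦ : ∀ ξ ∈ F, H (Φ ξ) = Real.fourierChar (r * ⟪e, ξ⟫) • ((d ξ)⁻¹ • k ξ) := fun ξ hξ => by
    simp only [hH, hinv ξ hξ]
  have hdH : ∀ ξ ∈ F, d ξ • H (Φ ξ) = Real.fourierChar (r * ⟪e, ξ⟫) • k ξ := fun ξ hξ => by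
    rw [hHΦ ξ hξ, smul_comm, smul_smul (d ξ), mul_inv_cancel₀ (hdpos ξ hξ).ne', one_smul]
  have hHint : IntegrableOn H (Φ '' F) := by
    rw [integrableOn_image_iff_integrableOn_abs_det_fderiv_smul volume hF hf' hinj]
    refine IntegrableOn.congr_fun
      (integrable_fourierChar_smul (b := fun ξ => r * ⟪e, ξ⟫) (by fun_prop) hh).integrableOn
      (fun ξ hξ => ?_) hF
    simp only [hdet ξ hξ]
    exact (hdH ξ hξ).symm
  have hGint : Integrable ((Φ '' F).indicator H) := hHint.integrable_indicator hΦF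
  have hnorm : eLpNorm ((Φ '' F).indicator H) 2 ^ 2 ≤ 2 * eLpNorm h 2 ^ 2 := by
    rw [eLpNorm_indicator_eq_eLpNorm_restrict hΦF, eLpNorm_two_sq, eLpNorm_two_sq,
      lintegral_image_eq_lintegral_abs_det_fderiv_mul volume hF hf' hinj,
      ← lintegral_const_mul' _ _ (by simp)]
    refine le_trans (setLIntegral_mono' hF fun ξ hξ => ?_) (setLIntegral_le_lintegral F _)
    rw [hdet ξ hξ, hHΦ ξ hξ]
    have h0 := hdpos ξ hξ
    have h1 : ‖Real.fourierChar (r * ⟪e, ξ⟫) • ((d ξ)⁻¹ • k ξ)‖ ^ 2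
        = (d ξ)⁻¹ ^ 2 * (‖gradient a ξ‖ * ‖h ξ‖ ^ 2) := by
      rw [Circle.norm_smul, norm_smul, hk, norm_mul, Complex.norm_real,
        Real.norm_of_nonneg (inv_nonneg.2 h0.le), Real.norm_of_nonneg (Real.sqrt_nonneg _),
        mul_pow, mul_pow, Real.sq_sqrt (norm_nonneg _)]
    rw [← ofReal_norm, ← ofReal_norm, ← ENNReal.ofReal_pow (norm_nonneg _), h1,
      ← ENNReal.ofReal_pow (norm_nonneg _), ← ENNReal.ofReal_mul h0.le,
      show (2 : ℝ≥0∞) = ENNReal.ofReal 2 by simp, ← ENNReal.ofReal_mul (by norm_num)]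
    refine ENNReal.ofReal_le_ofReal ?_
    -- The Jacobian cancels one of the two factors `(d ξ)⁻¹`; the quotient that remains is below `2`
    -- by `hpos`.
    have h3 : d ξ * ((d ξ)⁻¹ ^ 2 * (‖gradient a ξ‖ * ‖h ξ‖ ^ 2))
        = (‖gradient a ξ‖ / d ξ) * ‖h ξ‖ ^ 2 := by field_simp
    rw [h3]
    gcongr
    rw [div_le_iff₀ h0]
    exact (hpos ξ hξ).le
  refine ⟨_, hGint, ⟨hGint.1, ?_⟩, hnorm, fun y => ?_⟩
  · have : eLpNorm ((Φ '' F).indicator H) 2 volume ^ 2 < ⊤ :=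
      hnorm.trans_lt (ENNReal.mul_lt_top (by simp) (ENNReal.pow_lt_top hh2.2))
    exact lt_top_iff_ne_top.2 fun h0 => by simp [h0] at this
  · rw [Real.fourierInv_eq, evolution_eq_integral]
    have e1 : (fun η => Real.fourierChar ⟪η, y⟫ • (Φ '' F).indicator H η)
        = (Φ '' F).indicator (fun η => Real.fourierChar ⟪η, y⟫ • H η) := by
      funext η
      by_cases hη : η ∈ Φ '' F <;> simp [hη]
    rw [e1, integral_indicator hΦF,
      integral_image_eq_integral_abs_det_fderiv_smul volume hF hf' hinj]
    symm
    rw [← setIntegral_eq_integral_of_forall_compl_eq_zero (s := F)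
      (fun ξ hξ => by rw [hhF ξ hξ, mul_zero, smul_zero])]
    symm
    refine setIntegral_congr_fun hF fun ξ hξ => ?_
    rw [hdet ξ hξ, smul_comm, hdH ξ hξ, smul_smul, ← AddChar.map_add_eq_mul]
    -- With `(t, x) = swapAlong e (r, y)`, the phases agree: `⟪Φ ξ, y⟫ + r ⟪e, ξ⟫ = ⟪ξ, x⟫ + t a ξ`.
    congr 2
    simp [hΦ, straighten, swapAlong, inner_add_left, inner_add_right, inner_smul_left,
      inner_smul_right, real_inner_comm]
    ring

/-- The smoothing estimate for frequencies in a set on which `∇a` is controlled by the derivative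
of `a` along `e`, and on which `a` is injective along the lines parallel to `e`. -/
theorem admissible_of_injOn {a : V → ℝ} (ha : Measurable a) {e : V} (he : ‖e‖ = 1) {s : ℝ}
    (hs : 1 / 2 < s) {F : Set V} (hF : MeasurableSet F) (hd : ∀ ξ ∈ F, DifferentiableAt ℝ a ξ)
    (hpos : ∀ ξ ∈ F, ‖gradient a ξ‖ < 2 * fderiv ℝ a ξ e)
    (hinj : Set.InjOn (straighten a e) F) : Admissible a s F := by
  set I : ℝ≥0∞ := ∫⁻ r : ℝ, ‖bracketWeight s r‖ₑ ^ 2 with hI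
  have hI_top : I < ⊤ := lintegral_bracketWeight_sq_lt_top hs
  have hC_top : (2 * I) ^ (1 / 2 : ℝ) ≠ ⊤ :=
    ENNReal.rpow_ne_top_of_nonneg (y := 1 / 2) (by norm_num) (ENNReal.mul_ne_top (by simp) hI_top.ne)
  refine ⟨((2 * I) ^ (1 / 2 : ℝ)).toNNReal, fun h hh2 hh hhF => ?_⟩
  rw [ENNReal.coe_toNNReal hC_top]
  refine eLpNorm_two_le_of_lintegral_le ?_
  have hcont := continuous_evolution ha hh
  have hT := measurePreserving_swapAlong he
  have hm : Measurable fun p : ℝ × V => ‖(bracketWeight s p.2 : ℂ) * evolution a h p‖ₑ ^ 2 := by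
    have h1 := (continuous_bracketWeight (W := V) s).measurable
    have h2 := hcont.measurable
    fun_prop
  have hm2 : Measurable fun p : ℝ × V =>
      ‖bracketWeight s p.1‖ₑ ^ 2 * ‖evolution a h (swapAlong e p)‖ₑ ^ 2 := by
    have h1 := (continuous_bracketWeight (W := ℝ) s).measurable
    have h2 := hcont.measurable.comp hT.measurable
    have h3 : Measurable fun p : ℝ × V => evolution a h (swapAlong e p) := h2
    fun_prop
  -- From here on the first coordinate is the component of `x` along `e`, and the component of the
  -- second along `e` is time.
  rw [← hT.lintegral_comp hm]
  calc ∫⁻ p : ℝ × V, ‖(bracketWeight s (swapAlong e p).2 : ℂ) * evolution a h (swapAlong e p)‖ₑ ^ 2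
      ≤ ∫⁻ p : ℝ × V, ‖bracketWeight s p.1‖ₑ ^ 2 * ‖evolution a h (swapAlong e p)‖ₑ ^ 2 := by
        refine lintegral_mono fun p => ?_
        rw [enorm_mul, mul_pow]
        gcongr
        rw [← ofReal_norm, ← ofReal_norm, Complex.norm_real,
          Real.norm_of_nonneg (bracketWeight_nonneg _ _),
          Real.norm_of_nonneg (bracketWeight_nonneg _ _)]
        refine ENNReal.ofReal_le_ofReal ?_
        have := bracketWeight_le_inner (s := s) (by linarith) he (swapAlong e p).2
        rwa [inner_swapAlong he] at this
    _ = ∫⁻ r : ℝ, ∫⁻ y : V, ‖bracketWeight s r‖ₑ ^ 2 * ‖evolution a h (swapAlong e (r, y))‖ₑ ^ 2 :=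
        lintegral_prod _ hm2.aemeasurable
    _ ≤ ∫⁻ r : ℝ, ‖bracketWeight s r‖ₑ ^ 2 * (2 * eLpNorm h 2 ^ 2) := by
        refine lintegral_mono fun r => ?_
        rw [lintegral_const_mul' _ _ (by simp)]
        gcongr
        obtain ⟨G, hG, hG2, hGn, hGe⟩ :=
          exists_fourierInv_eq_evolution he hF hd hpos hinj hh hh2 hhF r
        simp only [← hGe]
        rwa [← eLpNorm_two_sq, eLpNorm_fourierInv_eq hG hG2]
    _ = 2 * I * ∫⁻ ξ, ‖h ξ‖ₑ ^ 2 := by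
        rw [lintegral_mul_const' _ _ (ENNReal.mul_ne_top (by simp) (ENNReal.pow_ne_top hh2.2.ne)),
          eLpNorm_two_sq]
        ring

end

noncomputable section

open scoped RealInnerProductSpace Topology

/-! ### Finite unions of admissible sets -/

section Admissible

variable {V : Type*} [NormedAddCommGroup V] [InnerProductSpace ℝ V] [FiniteDimensional ℝ V]
  [MeasurableSpace V] [BorelSpace V]

theorem admissible_empty (a : V → ℝ) (s : ℝ) : Admissible a s ∅ := by
  refine ⟨0, fun g _ _ h0 => ?_⟩
  have : g = 0 := funext fun ξ => h0 ξ (Set.notMem_empty ξ)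
  simp [this, evolution_eq_integral]

theorem aestronglyMeasurable_bracketWeight_mul_evolution {a : V → ℝ} (ha : Measurable a) (s : ℝ)
    {h : V → ℂ} (hh : Integrable (fun ξ => (√‖gradient a ξ‖ : ℂ) * h ξ)) :
    AEStronglyMeasurable (fun p : ℝ × V => (bracketWeight s p.2 : ℂ) * evolution a h p) := by
  have h1 := continuous_evolution ha hh
  have h2 := continuous_bracketWeight (W := V) s
  exact Continuous.aestronglyMeasurable (by fun_prop)

theorem integrable_mul_indicator {g h : V → ℂ} (hh : Integrable (fun ξ => g ξ * h ξ)) {F : Set V}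
    (hF : MeasurableSet F) : Integrable (fun ξ => g ξ * F.indicator h ξ) := by
  convert! hh.indicator hF using 2 with ξ
  by_cases hξ : ξ ∈ F <;> simp [hξ]

/-- Splitting a function over `F` and its complement, rather than over `F'`, makes the pieces
disjoint; the constants add. -/
theorem Admissible.union {a : V → ℝ} (ha : Measurable a) {s : ℝ} {F F' : Set V}
    (hF : MeasurableSet F) (h : Admissible a s F) (h' : Admissible a s F') :
    Admissible a s (F ∪ F') := by
  obtain ⟨C, hC⟩ := h
  obtain ⟨C', hC'⟩ := h'
  refine ⟨C + C', fun g hg hg' h0 => ?_⟩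
  have i1 := integrable_mul_indicator hg' hF
  have i2 := integrable_mul_indicator hg' hF.compl
  have e1 := hC _ (hg.indicator hF) i1 fun ξ hξ => Set.indicator_of_notMem hξ g
  have e2 := hC' _ (hg.indicator hF.compl) i2 fun ξ hξ => by
    by_cases hξF : ξ ∈ F
    · exact Set.indicator_of_notMem (by simpa using hξF) g
    · rw [Set.indicator_of_mem (by simpa using hξF)]
      exact h0 ξ (by simp [hξF, hξ])
  have hsum : (fun p : ℝ × V => (bracketWeight s p.2 : ℂ) * evolution a g p) =
      (fun p : ℝ × V => (bracketWeight s p.2 : ℂ) * evolution a (F.indicator g) p) +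
      fun p : ℝ × V => (bracketWeight s p.2 : ℂ) * evolution a (Fᶜ.indicator g) p := by
    funext p
    rw [Pi.add_apply, ← mul_add, ← evolution_add ha i1 i2, Set.indicator_self_add_compl]
  rw [hsum, ENNReal.coe_add, add_mul]
  refine (eLpNorm_add_le (aestronglyMeasurable_bracketWeight_mul_evolution ha s i1)
    (aestronglyMeasurable_bracketWeight_mul_evolution ha s i2) (by norm_num)).trans ?_
  refine add_le_add (e1.trans ?_) (e2.trans ?_)
  · gcongr
    exact eLpNorm_indicator_le g
  · gcongr
    exact eLpNorm_indicator_le g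

end Admissible

/-! ### Monotonicity along lines, choice of the direction, and cones -/

section Geometry

variable {V : Type*} [NormedAddCommGroup V] [InnerProductSpace ℝ V]

/-- The derivative of a homogeneous function is homogeneous. -/
theorem fderiv_smul_of_homogeneous {F : Type*} [NormedAddCommGroup F] [NormedSpace ℝ F]
    {f : V → F} {l c : ℝ} (hl : l ≠ 0) (hf : ∀ η ≠ 0, f (l • η) = (l * c) • f η) {ξ : V}
    (hξ : ξ ≠ 0) : fderiv ℝ f (l • ξ) = c • fderiv ℝ f ξ := by
  have h1 : (fun η => f (l • η)) =ᶠ[𝓝 ξ] fun η => (l * c) • f η := by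
    filter_upwards [isOpen_ne.mem_nhds hξ] with η hη using hf η hη
  have h2 := h1.fderiv_eq (𝕜 := ℝ)
  have h3 : fderiv ℝ (fun η => f (l • η)) ξ = l • fderiv ℝ f (l • ξ) := fderiv_comp_smul l
  have h4 : fderiv ℝ (fun η => (l * c) • f η) ξ = (l * c) • fderiv ℝ f ξ :=
    congrFun (fderiv_const_smul_field (l * c)) ξ
  rw [h3, h4, mul_smul] at h2
  exact smul_right_injective _ hl h2

/-- If the derivative along `e` is positive at two points of a segment parallel to `e`, and it
either has a constant sign or is strictly monotone on the segment, then the function takes a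
larger value at the second point. -/
theorem lt_of_fderiv_pos_of_convex {a : V → ℝ} {Γ : Set V} (hΓ : Convex ℝ Γ)
    (hd : ∀ ξ ∈ Γ, DifferentiableAt ℝ a ξ) (hd2 : ∀ ξ ∈ Γ, DifferentiableAt ℝ (fderiv ℝ a) ξ)
    {e : V} (hcase : (∀ ξ ∈ Γ, 0 < fderiv ℝ a ξ e) ∨ (∀ ξ ∈ Γ, fderiv ℝ a ξ e < 0) ∨
      (∀ ξ ∈ Γ, 0 < fderiv ℝ (fderiv ℝ a) ξ e e) ∨ (∀ ξ ∈ Γ, fderiv ℝ (fderiv ℝ a) ξ e e < 0))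
    {ξ : V} {r : ℝ} (hr : 0 < r) (h0 : ξ ∈ Γ) (h1 : ξ + r • e ∈ Γ) (hp0 : 0 < fderiv ℝ a ξ e)
    (hp1 : 0 < fderiv ℝ a (ξ + r • e) e) : a ξ < a (ξ + r • e) := by
  have hseg : ∀ t ∈ Set.Icc 0 r, ξ + t • e ∈ Γ := fun t ht => by
    have h := hΓ.add_smul_mem h0 h1 (t := t / r)
      ⟨div_nonneg ht.1 hr.le, (div_le_one hr).2 ht.2⟩
    rwa [smul_smul, div_mul_cancel₀ _ hr.ne'] at h
  have hline : ∀ t : ℝ, HasDerivAt (fun t : ℝ => ξ + t • e) e t := fun t => by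
    simpa using ((hasDerivAt_id t).smul_const e).const_add ξ
  have hda : ∀ t ∈ Set.Icc 0 r,
      HasDerivAt (fun t : ℝ => a (ξ + t • e)) (fderiv ℝ a (ξ + t • e) e) t := fun t ht =>
    (hd _ (hseg t ht)).hasFDerivAt.comp_hasDerivAt t (hline t)
  have hdd : ∀ t ∈ Set.Icc 0 r, HasDerivAt (fun t : ℝ => fderiv ℝ a (ξ + t • e) e)
      (fderiv ℝ (fderiv ℝ a) (ξ + t • e) e e) t := fun t ht => by
    have h : HasDerivAt (fun t : ℝ => fderiv ℝ a (ξ + t • e))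
        (fderiv ℝ (fderiv ℝ a) (ξ + t • e) e) t :=
      (hd2 _ (hseg t ht)).hasFDerivAt.comp_hasDerivAt t (hline t)
    exact (ContinuousLinearMap.apply ℝ ℝ e).hasFDerivAt.comp_hasDerivAt t h
  have hl : (0 : ℝ) ∈ Set.Icc 0 r := ⟨le_rfl, hr.le⟩
  have hu : r ∈ Set.Icc 0 r := ⟨hr.le, le_rfl⟩
  -- When the derivative is monotone, its value on the segment is at least its value at one
  -- endpoint: the left one if it increases, the right one if it decreases.
  have hpos : ∀ t ∈ Set.Icc 0 r, 0 < fderiv ℝ a (ξ + t • e) e := by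
    intro t ht
    rcases hcase with h | h | h | h
    · exact h _ (hseg t ht)
    · exact absurd hp0 (h ξ h0).not_gt
    · have hm : MonotoneOn (fun t : ℝ => fderiv ℝ a (ξ + t • e) e) (Set.Icc 0 r) :=
        monotoneOn_of_hasDerivWithinAt_nonneg (convex_Icc 0 r)
          (fun t ht => (hdd t ht).continuousAt.continuousWithinAt)
          (fun t ht => (hdd t (interior_subset ht)).hasDerivWithinAt)
          (fun t ht => (h _ (hseg t (interior_subset ht))).le)
      have := hm hl ht ht.1
      simp only [zero_smul, add_zero] at this
      linarith
    · have hm : AntitoneOn (fun t : ℝ => fderiv ℝ a (ξ + t • e) e) (Set.Icc 0 r) :=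
        antitoneOn_of_hasDerivWithinAt_nonpos (convex_Icc 0 r)
          (fun t ht => (hdd t ht).continuousAt.continuousWithinAt)
          (fun t ht => (hdd t (interior_subset ht)).hasDerivWithinAt)
          (fun t ht => (h _ (hseg t (interior_subset ht))).le)
      have := hm ht hu ht.2
      linarith
  have hm : StrictMonoOn (fun t : ℝ => a (ξ + t • e)) (Set.Icc 0 r) :=
    strictMonoOn_of_hasDerivWithinAt_pos (convex_Icc 0 r)
      (fun t ht => (hda t ht).continuousAt.continuousWithinAt)
      (fun t ht => (hda t (interior_subset ht)).hasDerivWithinAt)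
      (fun t ht => hpos t (interior_subset ht))
  simpa using hm hl hu hr

/-- Two points with the same image have the same value of `a` and differ by a multiple of `e`, so
growth of `a` along `e` separates them. -/
theorem injOn_straighten {a : V → ℝ} {e : V} (he : ‖e‖ = 1) {F : Set V}
    (h : ∀ ξ ∈ F, ∀ r : ℝ, 0 < r → ξ + r • e ∈ F → a ξ < a (ξ + r • e)) :
    Set.InjOn (straighten a e) F := by
  have key : ∀ ξ η : V, straighten a e ξ = straighten a e η →
      a ξ = a η ∧ η = ξ + (⟪e, η⟫ - ⟪e, ξ⟫) • e := by
    intro ξ η hξη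
    have h1 : a ξ = a η := by
      have := congrArg (fun x => ⟪e, x⟫) hξη
      simpa [straighten, inner_add_right, inner_smul_right, he] using this
    refine ⟨h1, ?_⟩
    simp only [straighten, h1] at hξη
    have : η = ξ + (a η - ⟪e, ξ⟫) • e - (a η - ⟪e, η⟫) • e := by rw [hξη]; module
    rw [this]
    simp only [inner_add_right, inner_sub_right, inner_smul_right, real_inner_self_eq_norm_sq, he]
    module
  intro ξ hξ η hη hξη
  obtain ⟨h1, h2⟩ := key ξ η hξη
  obtain ⟨-, h3⟩ := key η ξ hξη.symm
  rcases lt_trichotomy ⟪e, ξ⟫ ⟪e, η⟫ with hlt | heq | hgt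
  · have := h ξ hξ _ (sub_pos.2 hlt) (h2 ▸ hη)
    rw [← h2] at this
    exact absurd h1 this.ne
  · rw [h2, heq]; simp
  · have := h η hη _ (sub_pos.2 hgt) (h3 ▸ hξ)
    rw [← h3] at this
    exact absurd h1 this.ne'

/-- A nonzero covector, or a nonzero symmetric bilinear form, is nonzero at a unit vector close to
a given one. -/
theorem exists_unit_inner_gt {L : V →L[ℝ] ℝ} {B : V →L[ℝ] V →L[ℝ] ℝ} (hB : ∀ x y, B x y = B y x)
    (hLB : L = 0 → B ≠ 0) {v : V} (hv : ‖v‖ = 1) :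
    ∃ e : V, ‖e‖ = 1 ∧ 1 / 2 < ⟪v, e⟫ ∧ (L e ≠ 0 ∨ B e e ≠ 0) := by
  -- For every `ε ≠ 0` one of `v`, `v ± ε w` works. If `L ≠ 0`, take `L w ≠ 0` and use linearity; if
  -- `L = 0`, take `B w w ≠ 0`, and the second difference of the quadratic form is `2 ε² B w w`.
  obtain ⟨w, hw0, hw⟩ : ∃ w : V, w ≠ 0 ∧ ∀ ε : ℝ, ε ≠ 0 → (L v ≠ 0 ∨ B v v ≠ 0) ∨
      (L (v + ε • w) ≠ 0 ∨ B (v + ε • w) (v + ε • w) ≠ 0) ∨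
      (L (v + (-ε) • w) ≠ 0 ∨ B (v + (-ε) • w) (v + (-ε) • w) ≠ 0) := by
    by_cases hL : L = 0
    · obtain ⟨w, hw⟩ : ∃ w, B w w ≠ 0 := by
        by_contra! hcon
        refine hLB hL ?_
        ext x y
        have h1 := hcon (x + y)
        simp only [map_add, add_apply, hcon x, hcon y, hB y x] at h1
        simp only [zero_apply]
        linarith
      refine ⟨w, fun h => hw (by simp [h]), fun ε hε => ?_⟩
      by_contra! hcon
      obtain ⟨⟨-, h1⟩, ⟨-, h2⟩, -, h3⟩ := hcon
      simp only [map_add, map_smul, add_apply, smul_apply,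
        smul_eq_mul, h1, hB w v] at h2 h3
      have : ε * ε * B w w = 0 := by linarith
      simp_all
    · obtain ⟨w, hw⟩ : ∃ w, L w ≠ 0 := by
        by_contra! hcon
        exact hL (ContinuousLinearMap.ext hcon)
      refine ⟨w, fun h => hw (by simp [h]), fun ε hε => ?_⟩
      by_contra! hcon
      obtain ⟨⟨h1, -⟩, ⟨h2, -⟩, -⟩ := hcon
      simp_all
  -- Within distance `1/4` of `v` one has `⟪v, u⟫ ≥ 3/4` and `‖u‖ ≤ 5/4`, so normalizing leaves an
  -- inner product of at least `3/5 > 1/2`.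
  have key : ∀ u : V, ‖u - v‖ ≤ 1 / 4 → (L u ≠ 0 ∨ B u u ≠ 0) →
      ∃ e : V, ‖e‖ = 1 ∧ 1 / 2 < ⟪v, e⟫ ∧ (L e ≠ 0 ∨ B e e ≠ 0) := by
    intro u hu hLBu
    have h1 : 3 / 4 ≤ ⟪v, u⟫ := by
      have := abs_real_inner_le_norm v (u - v)
      rw [inner_sub_right, real_inner_self_eq_norm_sq, hv, one_mul] at this
      have := (abs_le.1 (this.trans hu)).1
      linarith
    have h2 : ‖u‖ ≤ 5 / 4 := by
      have := norm_le_norm_add_norm_sub' u v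
      linarith
    have h3 : 0 < ‖u‖ := by
      have := real_inner_le_norm v u
      rw [hv] at this
      linarith
    refine ⟨‖u‖⁻¹ • u, by rw [norm_smul, norm_inv, norm_norm, inv_mul_cancel₀ h3.ne'], ?_, ?_⟩
    · rw [inner_smul_right, ← div_eq_inv_mul, lt_div_iff₀ h3]
      linarith
    · simpa [h3.ne'] using hLBu
  set ε : ℝ := (4 * ‖w‖)⁻¹ with hε
  have hwp : 0 < ‖w‖ := norm_pos_iff.2 hw0
  have hεw : |ε| * ‖w‖ = 1 / 4 := by
    rw [abs_of_pos (by positivity), hε]; field_simp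
  rcases hw ε (by positivity) with h | h | h
  · exact key v (by simp) h
  · exact key _ (by simp [norm_smul, hεw]) h
  · exact key _ (by simp [norm_smul, hεw]) h

/-- The open convex cone around `ξ₀`. -/
def coneAround (ξ₀ : V) (δ : ℝ) : Set V := {ξ | (1 - δ) * ‖ξ‖ < ⟪ξ₀, ξ⟫}

theorem isOpen_coneAround (ξ₀ : V) (δ : ℝ) : IsOpen (coneAround ξ₀ δ) :=
  isOpen_lt (by fun_prop) (by fun_prop)

theorem ne_zero_of_mem_coneAround {ξ₀ ξ : V} {δ : ℝ} (h : ξ ∈ coneAround ξ₀ δ) : ξ ≠ 0 := by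
  rintro rfl
  simp [coneAround] at h

/-- For `δ ≤ 1` the function `(1 - δ) ‖ξ‖ - ⟪ξ₀, ξ⟫` is convex, and the cone is where it is
negative. -/
theorem convex_coneAround (ξ₀ : V) {δ : ℝ} (hδ : δ ≤ 1) : Convex ℝ (coneAround ξ₀ δ) := by
  rw [convex_iff_add_mem]
  intro x hx y hy p q hp hq hpq
  simp only [coneAround, Set.mem_ofPred_eq, inner_add_right, inner_smul_right] at *
  have h1 : ‖p • x + q • y‖ ≤ p * ‖x‖ + q * ‖y‖ := by
    refine (norm_add_le _ _).trans_eq ?_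
    rw [norm_smul, norm_smul, Real.norm_of_nonneg hp, Real.norm_of_nonneg hq]
  have h2 := mul_le_mul_of_nonneg_left h1 (sub_nonneg.2 hδ)
  rcases hp.eq_or_lt with rfl | hp'
  · obtain rfl : q = 1 := by linarith
    linarith
  · nlinarith [mul_lt_mul_of_pos_left hx hp', mul_le_mul_of_nonneg_left hy.le hq]

theorem smul_mem_coneAround_iff {ξ₀ ξ : V} {δ l : ℝ} (hl : 0 < l) :
    l • ξ ∈ coneAround ξ₀ δ ↔ ξ ∈ coneAround ξ₀ δ := by
  simp only [coneAround, Set.mem_ofPred_eq, norm_smul, inner_smul_right, Real.norm_of_nonneg hl.le]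
  rw [mul_left_comm, mul_lt_mul_iff_right₀ hl]

/-- A property that is invariant under scaling and holds near a unit vector holds in a cone. -/
theorem exists_coneAround {P : V → Prop} (hP : ∀ ξ ≠ 0, ∀ l : ℝ, 0 < l → P (l • ξ) → P ξ) {ξ₀ : V}
    (hξ₀ : ‖ξ₀‖ = 1) (h : ∀ᶠ ξ in 𝓝 ξ₀, P ξ) :
    ∃ δ : ℝ, 0 < δ ∧ δ ≤ 1 ∧ ∀ ξ ∈ coneAround ξ₀ δ, P ξ := by
  obtain ⟨ρ, hρ, hball⟩ := Metric.eventually_nhds_iff.1 h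
  -- For a unit vector `η` in the cone, `‖η - ξ₀‖² = 2 - 2 ⟪ξ₀, η⟫ < 2δ ≤ ρ²`.
  refine ⟨min 1 (ρ ^ 2 / 2), by positivity, min_le_left _ _, fun ξ hξ => ?_⟩
  have h0 := ne_zero_of_mem_coneAround hξ
  have hl : 0 < ‖ξ‖⁻¹ := by positivity
  refine hP ξ h0 _ hl (hball ?_)
  rw [← smul_mem_coneAround_iff hl] at hξ
  have h1 : ‖‖ξ‖⁻¹ • ξ‖ = 1 := by
    rw [norm_smul, norm_inv, norm_norm, inv_mul_cancel₀ (norm_ne_zero_iff.2 h0)]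
  simp only [coneAround, Set.mem_ofPred_eq, h1, mul_one] at hξ
  rw [dist_eq_norm]
  have h2 := norm_sub_sq_real (‖ξ‖⁻¹ • ξ) ξ₀
  rw [h1, hξ₀, real_inner_comm] at h2
  have h3 := min_le_right 1 (ρ ^ 2 / 2)
  exact lt_of_pow_lt_pow_left₀ 2 hρ.le (by linarith)

end Geometry

/-! ### Covering the frequencies by compactness -/

section Covering

variable {V : Type*} [NormedAddCommGroup V] [InnerProductSpace ℝ V] [FiniteDimensional ℝ V]
  [MeasurableSpace V] [BorelSpace V]

/-- All frequencies near a given direction, with `∇a` near a given direction, are admissible. -/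
theorem exists_nhds_admissible {a : V → ℝ} (hm : Measurable a) (ha : ContDiffOn ℝ ∞ a {0}ᶜ)
    (hhom : ∀ l : ℝ, 0 < l → ∀ ξ : V, ξ ≠ 0 → a (l • ξ) = l ^ 2 * a ξ)
    (hhess : ∀ ξ : V, ξ ≠ 0 → fderiv ℝ a ξ = 0 → fderiv ℝ (fderiv ℝ a) ξ ≠ 0)
    {s : ℝ} (hs : 1 / 2 < s) {ξ₀ v : V} (hξ₀ : ‖ξ₀‖ = 1) (hv : ‖v‖ = 1) :
    ∃ S ∈ 𝓝 (ξ₀, v), ∃ F : Set V, MeasurableSet F ∧ Admissible a s F ∧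
      ∀ ξ : V, ξ ≠ 0 → gradient a ξ ≠ 0 →
        (‖ξ‖⁻¹ • ξ, ‖gradient a ξ‖⁻¹ • gradient a ξ) ∈ S → ξ ∈ F := by
  have hA : ∀ ξ ≠ 0, ContDiffAt ℝ ∞ a ξ := fun ξ hξ =>
    ha.contDiffAt (isOpen_compl_singleton.mem_nhds hξ)
  have hA1 : ∀ ξ ≠ 0, ContDiffAt ℝ ∞ (fderiv ℝ a) ξ := fun ξ hξ =>
    (hA ξ hξ).fderiv_right (by simp)
  have hA2 : ∀ ξ ≠ 0, ContDiffAt ℝ ∞ (fderiv ℝ (fderiv ℝ a)) ξ := fun ξ hξ =>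
    (hA1 ξ hξ).fderiv_right (by simp)
  have hh1 : ∀ ξ ≠ 0, ∀ l : ℝ, 0 < l → fderiv ℝ a (l • ξ) = l • fderiv ℝ a ξ := fun ξ hξ l hl =>
    fderiv_smul_of_homogeneous hl.ne' (fun η hη => by rw [hhom l hl η hη, smul_eq_mul, sq]) hξ
  have hh2 : ∀ ξ ≠ 0, ∀ l : ℝ, 0 < l →
      fderiv ℝ (fderiv ℝ a) (l • ξ) = fderiv ℝ (fderiv ℝ a) ξ := fun ξ hξ l hl => by
    rw [fderiv_smul_of_homogeneous (c := 1) hl.ne'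
      (fun η hη => by rw [hh1 η hη l hl, mul_one]) hξ, one_smul]
  have hξ₀0 : ξ₀ ≠ 0 := fun h => by simp [h] at hξ₀
  have hsymm : IsSymmSndFDerivAt ℝ a ξ₀ := (hA ξ₀ hξ₀0).isSymmSndFDerivAt
    (by simpa using WithTop.coe_le_coe.2 (le_top : (2 : ℕ∞) ≤ ⊤))
  obtain ⟨e, he, hve, hLB⟩ := exists_unit_inner_gt (fun x y => hsymm.eq x y) (hhess ξ₀ hξ₀0) hv
  have hc1 : ContinuousAt (fun ξ => fderiv ℝ a ξ e) ξ₀ :=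
    (hA1 ξ₀ hξ₀0).continuousAt.clm_apply continuousAt_const
  have hc2 : ContinuousAt (fun ξ => fderiv ℝ (fderiv ℝ a) ξ e e) ξ₀ :=
    ((hA2 ξ₀ hξ₀0).continuousAt.clm_apply continuousAt_const).clm_apply continuousAt_const
  -- The sign at `ξ₀` persists nearby by continuity, and in a cone because `∂ₑa` and `∂ₑ²a` are
  -- homogeneous of degrees one and zero.
  obtain ⟨δ, hδ, hδ1, hcase⟩ : ∃ δ : ℝ, 0 < δ ∧ δ ≤ 1 ∧
      ((∀ ξ ∈ coneAround ξ₀ δ, 0 < fderiv ℝ a ξ e) ∨ (∀ ξ ∈ coneAround ξ₀ δ, fderiv ℝ a ξ e < 0) ∨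
      (∀ ξ ∈ coneAround ξ₀ δ, 0 < fderiv ℝ (fderiv ℝ a) ξ e e) ∨
      (∀ ξ ∈ coneAround ξ₀ δ, fderiv ℝ (fderiv ℝ a) ξ e e < 0)) := by
    rcases hLB with h | h <;> rcases lt_or_gt_of_ne h with h | h
    · obtain ⟨δ, h1, h2, h3⟩ := exists_coneAround (P := fun ξ => fderiv ℝ a ξ e < 0)
        (fun ξ hξ l hl h => by
          rw [hh1 ξ hξ l hl] at h
          exact (smul_neg_iff_of_pos_left hl).1 h) hξ₀ (hc1.eventually_lt continuousAt_const h)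
      exact ⟨δ, h1, h2, .inr (.inl h3)⟩
    · obtain ⟨δ, h1, h2, h3⟩ := exists_coneAround (P := fun ξ => 0 < fderiv ℝ a ξ e)
        (fun ξ hξ l hl h => by
          rw [hh1 ξ hξ l hl] at h
          exact (smul_pos_iff_of_pos_left hl).1 h) hξ₀ (continuousAt_const.eventually_lt hc1 h)
      exact ⟨δ, h1, h2, .inl h3⟩
    · obtain ⟨δ, h1, h2, h3⟩ := exists_coneAround
        (P := fun ξ => fderiv ℝ (fderiv ℝ a) ξ e e < 0)
        (fun ξ hξ l hl h => by rwa [hh2 ξ hξ l hl] at h) hξ₀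
        (hc2.eventually_lt continuousAt_const h)
      exact ⟨δ, h1, h2, .inr (.inr (.inr h3))⟩
    · obtain ⟨δ, h1, h2, h3⟩ := exists_coneAround
        (P := fun ξ => 0 < fderiv ℝ (fderiv ℝ a) ξ e e)
        (fun ξ hξ l hl h => by rwa [hh2 ξ hξ l hl] at h) hξ₀
        (continuousAt_const.eventually_lt hc2 h)
      exact ⟨δ, h1, h2, .inr (.inr (.inl h3))⟩
  set F : Set V := coneAround ξ₀ δ ∩ {ξ | ‖gradient a ξ‖ < 2 * fderiv ℝ a ξ e} with hF
  have hFm : MeasurableSet F := by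
    refine (isOpen_coneAround ξ₀ δ).measurableSet.inter (measurableSet_lt ?_ ?_)
    · simp only [norm_gradient]
      exact (measurable_fderiv ℝ a).norm
    · exact (measurable_fderiv_apply_const ℝ a e).const_mul 2
  have hpos : ∀ ξ ∈ F, 0 < fderiv ℝ a ξ e := fun ξ hξ => by
    have h1 : ‖gradient a ξ‖ < 2 * fderiv ℝ a ξ e := hξ.2
    have h2 := norm_nonneg (gradient a ξ)
    linarith
  have hda : ∀ ξ ∈ coneAround ξ₀ δ, DifferentiableAt ℝ a ξ := fun ξ hξ =>
    (hA ξ (ne_zero_of_mem_coneAround hξ)).differentiableAt (by simp)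
  have hFadm : Admissible a s F := by
    refine admissible_of_injOn hm he hs hFm (fun ξ hξ => hda ξ hξ.1) (fun ξ hξ => hξ.2)
      (injOn_straighten he fun ξ hξ r hr hξr => ?_)
    exact lt_of_fderiv_pos_of_convex (convex_coneAround ξ₀ hδ1) hda
      (fun ξ hξ => (hA1 ξ (ne_zero_of_mem_coneAround hξ)).differentiableAt (by simp)) hcase hr
      hξ.1 hξr.1 (hpos _ hξ) (hpos _ hξr)
  refine ⟨coneAround ξ₀ δ ×ˢ {u | 1 / 2 < ⟪u, e⟫}, ?_, F, hFm, hFadm, ?_⟩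
  · refine ((isOpen_coneAround ξ₀ δ).prod (isOpen_lt (by fun_prop) (by fun_prop))).mem_nhds
      ⟨?_, hve⟩
    simp only [coneAround, Set.mem_ofPred_eq, real_inner_self_eq_norm_sq, hξ₀]
    linarith
  · rintro ξ hξ hg ⟨h1, h2⟩
    refine ⟨(smul_mem_coneAround_iff (by positivity)).1 h1, ?_⟩
    have hg' : 0 < ‖gradient a ξ‖ := norm_pos_iff.2 hg
    simp only [Set.mem_ofPred_eq, inner_smul_left, inner_gradient_left, RCLike.conj_to_real] at h2 ⊢
    rw [← div_eq_inv_mul, lt_div_iff₀ hg'] at h2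
    linarith

/-- The smoothing estimate holds without restriction on the frequencies. -/
theorem exists_admissible {a : V → ℝ} (hm : Measurable a) (ha : ContDiffOn ℝ ∞ a {0}ᶜ)
    (hhom : ∀ l : ℝ, 0 < l → ∀ ξ : V, ξ ≠ 0 → a (l • ξ) = l ^ 2 * a ξ)
    (hhess : ∀ ξ : V, ξ ≠ 0 → fderiv ℝ a ξ = 0 → fderiv ℝ (fderiv ℝ a) ξ ≠ 0)
    {s : ℝ} (hs : 1 / 2 < s) :
    ∃ F : Set V, MeasurableSet F ∧ Admissible a s F ∧ ∀ ξ : V, ξ ≠ 0 → gradient a ξ ≠ 0 → ξ ∈ F := by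
  -- The direction of `∇a` is an independent variable on its own sphere, since it need not extend
  -- continuously to critical points.
  have hK : IsCompact (Metric.sphere (0 : V) 1 ×ˢ Metric.sphere (0 : V) 1) :=
    (isCompact_sphere 0 1).prod (isCompact_sphere 0 1)
  have hind := hK.induction_on (p := fun S => ∃ F : Set V, MeasurableSet F ∧ Admissible a s F ∧
      ∀ ξ : V, ξ ≠ 0 → gradient a ξ ≠ 0 →
        (‖ξ‖⁻¹ • ξ, ‖gradient a ξ‖⁻¹ • gradient a ξ) ∈ S → ξ ∈ F)
    ⟨∅, .empty, admissible_empty a s, fun ξ _ _ h => h⟩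
    (fun S T hST ⟨F, h1, h2, h3⟩ => ⟨F, h1, h2, fun ξ hξ hg h => h3 ξ hξ hg (hST h)⟩)
    (fun S T ⟨F, h1, h2, h3⟩ ⟨F', h1', h2', h3'⟩ => ⟨F ∪ F', h1.union h1', h2.union hm h1 h2',
      fun ξ hξ hg h => h.imp (h3 ξ hξ hg) (h3' ξ hξ hg)⟩)
    (fun x hx => by
      obtain ⟨S, hS, h⟩ := exists_nhds_admissible hm ha hhom hhess hs
        (mem_sphere_zero_iff_norm.1 hx.1) (mem_sphere_zero_iff_norm.1 hx.2)
      exact ⟨S, mem_nhdsWithin_of_mem_nhds hS, h⟩)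
  obtain ⟨F, h1, h2, h3⟩ := hind
  refine ⟨F, h1, h2, fun ξ hξ hg => h3 ξ hξ hg ⟨?_, ?_⟩⟩
  · simp [norm_smul, hξ]
  · simp only [mem_sphere_zero_iff_norm, norm_smul, norm_inv, norm_norm]
    exact inv_mul_cancel₀ (norm_ne_zero_iff.2 hg)

/-- The smoothing estimate for `h ∈ L²` such that the evolution is an absolutely convergent
integral. -/
theorem exists_eLpNorm_evolution_le {a : V → ℝ} (hm : Measurable a) (ha : ContDiffOn ℝ ∞ a {0}ᶜ)
    (hhom : ∀ l : ℝ, 0 < l → ∀ ξ : V, ξ ≠ 0 → a (l • ξ) = l ^ 2 * a ξ)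
    (hhess : ∀ ξ : V, ξ ≠ 0 → fderiv ℝ a ξ = 0 → fderiv ℝ (fderiv ℝ a) ξ ≠ 0)
    {s : ℝ} (hs : 1 / 2 < s) [Nontrivial V] :
    ∃ C : ℝ≥0, ∀ h : V → ℂ, MemLp h 2 → Integrable (fun ξ => (√‖gradient a ξ‖ : ℂ) * h ξ) →
      eLpNorm (fun p : ℝ × V => (bracketWeight s p.2 : ℂ) * evolution a h p) 2
        ≤ C * eLpNorm h 2 := by
  obtain ⟨F, hF, ⟨C, hC⟩, hcov⟩ := exists_admissible hm ha hhom hhess hs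
  refine ⟨C, fun h hh hh' => ?_⟩
  -- Outside `F` and the null set `{0}` the gradient vanishes, so the cut-off does not change the
  -- evolution.
  have hev : evolution a (F.indicator h) = evolution a h := by
    funext p
    simp only [evolution_eq_integral]
    refine integral_congr_ae ?_
    filter_upwards [compl_mem_ae_iff.2 (measure_singleton (0 : V))] with ξ hξ
    by_cases hξF : ξ ∈ F
    · simp [hξF]
    · have : gradient a ξ = 0 := by_contra fun hg => hξF (hcov ξ hξ hg)
      simp [this]
  have := hC (F.indicator h) (hh.indicator hF) (integrable_mul_indicator hh' hF)
    fun ξ hξ => Set.indicator_of_notMem hξ h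
  rw [hev] at this
  refine this.trans ?_
  gcongr
  exact eLpNorm_indicator_le h

end Covering
end

noncomputable section

open scoped RealInnerProductSpace Topology
open Filter

/-! ### Extension to all of `L²` -/

section Extension

variable {V : Type*} [NormedAddCommGroup V] [InnerProductSpace ℝ V] [FiniteDimensional ℝ V]
  [MeasurableSpace V] [BorelSpace V]

theorem enorm_integral_mul_le {α : Type*} [MeasurableSpace α] {μ : Measure α} {f g : α → ℂ}
    (hf : AEStronglyMeasurable f μ) (hg : AEStronglyMeasurable g μ) :
    ‖∫ x, f x * g x ∂μ‖ₑ ≤ eLpNorm f 2 μ * eLpNorm g 2 μ := by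
  refine (enorm_integral_le_lintegral_enorm _).trans ?_
  rw [← eLpNorm_one_eq_lintegral_enorm]
  simpa using eLpNorm_le_eLpNorm_mul_eLpNorm_of_nnnorm (p := 2) (q := 2) (r := 1) hf hg
    (fun y z => y * z) 1 (Eventually.of_forall fun x => by simp)

/-- Truncations to balls converge in `L²`. -/
theorem tendsto_eLpNorm_indicator_closedBall_sub {f : V → ℂ} (hf : MemLp f 2) :
    Tendsto (fun k : ℕ => eLpNorm ((Metric.closedBall (0 : V) k).indicator f - f) 2) atTop
      (𝓝 0) := by
  have h1 : Tendsto (fun k : ℕ => ∫⁻ x, ‖((Metric.closedBall (0 : V) k).indicator f - f) x‖ₑ ^ 2)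
      atTop (𝓝 (∫⁻ _ : V, 0)) := by
    refine tendsto_lintegral_of_dominated_convergence' (fun x => ‖f x‖ₑ ^ 2)
      (fun k => (((hf.1.indicator Metric.isClosed_closedBall.measurableSet).sub hf.1).enorm.pow_const
        2)) (fun k => Eventually.of_forall fun x => ?_) ?_ (Eventually.of_forall fun x => ?_)
    · by_cases hx : x ∈ Metric.closedBall (0 : V) k
      · simp [Set.indicator_of_mem hx]
      · simp [Set.indicator_of_notMem hx]
    · rw [← eLpNorm_two_sq]
      exact ENNReal.pow_ne_top hf.2.ne
    · refine tendsto_const_nhds.congr' ?_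
      filter_upwards [eventually_ge_atTop ⌈‖x‖⌉₊] with k hk
      have hx : x ∈ Metric.closedBall (0 : V) k := by
        simpa using Nat.ceil_le.1 hk
      simp [Set.indicator_of_mem hx]
  simp only [← eLpNorm_two_sq, lintegral_zero] at h1
  have h2 := h1.ennrpow_const (1 / 2)
  have h3 : ∀ y : ℝ≥0∞, (y ^ 2) ^ (1 / 2 : ℝ) = y := fun y => by
    rw [← ENNReal.rpow_natCast, ← ENNReal.rpow_mul]
    norm_num
  simp only [h3] at h2
  rwa [ENNReal.zero_rpow_of_pos (by norm_num)] at h2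

/-- If `W k → W` in `L²` of a product, then almost all slices of `W` are limit points of the
slices of `W k`. -/
theorem ae_frequently_eLpNorm_slice_lt {α β : Type*} [MeasurableSpace α] [MeasurableSpace β]
    {μ : Measure α} {ν : Measure β} [SFinite μ] [SFinite ν] {W : ℕ → α × β → ℂ}
    (hW : ∀ k, StronglyMeasurable (W k)) (h : Tendsto (fun k => eLpNorm (W k) 2 (μ.prod ν)) atTop
      (𝓝 0)) :
    ∀ᵐ t ∂μ, ∀ ε : ℝ≥0∞, 0 < ε → ∃ᶠ k in atTop, eLpNorm (fun x => W k (t, x)) 2 ν < ε := by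
  set D : ℕ → α → ℝ≥0∞ := fun k t => ∫⁻ x, ‖W k (t, x)‖ₑ ^ 2 ∂ν with hD
  have hDm : ∀ k, Measurable (D k) := fun k =>
    ((hW k).measurable.enorm.pow_const 2).lintegral_prod_right'
  have hint : ∀ k, ∫⁻ t, D k t ∂μ = eLpNorm (W k) 2 (μ.prod ν) ^ 2 := fun k => by
    rw [eLpNorm_two_sq, lintegral_prod _ ((hW k).measurable.enorm.pow_const 2).aemeasurable]
  -- By Fatou's lemma the lower limit of the slice norms vanishes for almost every `t`, so no
  -- subsequence has to be extracted.
  have h0 : ∫⁻ t, liminf (fun k => D k t) atTop ∂μ = 0 := by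
    refine le_antisymm ((lintegral_liminf_le hDm).trans ?_) zero_le
    have h2 : Tendsto (fun k => ∫⁻ t, D k t ∂μ) atTop (𝓝 0) := by
      simp only [hint]
      simpa using ENNReal.Tendsto.pow (n := 2) h
    exact h2.liminf_eq.le
  rw [lintegral_eq_zero_iff (Measurable.liminf hDm)] at h0
  filter_upwards [h0] with t ht ε hε
  have h1 : liminf (fun k => D k t) atTop < ε ^ 2 := by
    rw [ht]
    exact ENNReal.pow_pos hε 2
  refine (frequently_lt_of_liminf_lt (by isBoundedDefault) h1).mono fun k hk => ?_
  simp only [hD, ← eLpNorm_two_sq] at hk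
  by_contra! hcon
  exact absurd hk (not_lt.2 (by gcongr))

/-- The inverse weight has temperate growth. Moving it onto the test function turns the
distributional pairing into an `L²` pairing. -/
theorem memLp_bracketWeight_inv_mul (s : ℝ) (ψ : 𝓢(V, ℂ)) :
    MemLp (fun x => (bracketWeight s x : ℂ)⁻¹ * ψ x) 2 := by
  have hg := Function.hasTemperateGrowth_one_add_norm_sq_rpow V (s / 2)
  have h := (SchwartzMap.smulLeftCLM ℂ (fun x : V => (1 + ‖x‖ ^ 2) ^ (s / 2)) ψ).memLp 2
  rw [SchwartzMap.smulLeftCLM_apply hg] at h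
  convert! h using 2 with x
  rw [bracketWeight, neg_div, Real.rpow_neg (by positivity), Complex.ofReal_inv, inv_inv,
    Complex.real_smul]

theorem memLp_sqrt_norm_gradient_mul {a : V → ℝ} {K : ℝ} (hK : ∀ ξ ≠ 0, ‖gradient a ξ‖ ≤ K * ‖ξ‖)
    [Nontrivial V] (ψ : 𝓢(V, ℂ)) : MemLp (fun ξ => (√‖gradient a ξ‖ : ℂ) * ψ ξ) 2 := by
  have hg := Function.hasTemperateGrowth_one_add_norm_sq_rpow V (1 / 2)
  have h := (SchwartzMap.smulLeftCLM ℂ (fun x : V => (1 + ‖x‖ ^ 2) ^ (1 / 2 : ℝ)) ψ).memLp 2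
  rw [SchwartzMap.smulLeftCLM_apply hg] at h
  have hm : Measurable (fun ξ => (√‖gradient a ξ‖ : ℂ)) := by
    simp only [norm_gradient]
    have := (measurable_fderiv ℝ a).norm
    fun_prop
  refine h.of_le_mul (c := √K) (hm.aestronglyMeasurable.mul ψ.continuous.aestronglyMeasurable) ?_
  filter_upwards [compl_mem_ae_iff.2 (measure_singleton (0 : V))] with ξ hξ
  have hK0 : 0 ≤ K := by
    by_contra! hneg
    have h1 := hK ξ hξ
    have h2 : K * ‖ξ‖ < 0 := mul_neg_of_neg_of_pos hneg (norm_pos_iff.2 hξ)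
    linarith [norm_nonneg (gradient a ξ)]
  rw [norm_mul, norm_smul, ← mul_assoc, Complex.norm_real, Real.norm_of_nonneg (Real.sqrt_nonneg _),
    Real.norm_of_nonneg (by positivity), ← Real.sqrt_eq_rpow, ← Real.sqrt_mul hK0]
  gcongr
  refine (hK ξ hξ).trans ?_
  gcongr
  nlinarith [sq_nonneg (‖ξ‖ - 1)]

theorem integrable_sqrt_norm_gradient_mul_indicator {a : V → ℝ} {K : ℝ}
    (hK : ∀ ξ ≠ 0, ‖gradient a ξ‖ ≤ K * ‖ξ‖) [Nontrivial V] {f : V → ℂ} (hf : MemLp f 2) (k : ℕ) :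
    Integrable (fun ξ => (√‖gradient a ξ‖ : ℂ) * (Metric.closedBall (0 : V) k).indicator f ξ) := by
  have hB : MeasurableSet (Metric.closedBall (0 : V) k) := Metric.isClosed_closedBall.measurableSet
  have h1 : Integrable ((Metric.closedBall (0 : V) k).indicator f) := by
    rw [integrable_indicator_iff hB]
    have : IsFiniteMeasure (volume.restrict (Metric.closedBall (0 : V) k)) :=
      ⟨by simpa using measure_closedBall_lt_top⟩
    exact (hf.restrict _).integrable (by norm_num)
  have hm : Measurable (fun ξ => (√‖gradient a ξ‖ : ℂ)) := by
    simp only [norm_gradient]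
    have := (measurable_fderiv ℝ a).norm
    fun_prop
  refine (h1.norm.const_mul (√(|K| * k))).mono' (hm.aestronglyMeasurable.mul h1.1) ?_
  filter_upwards [compl_mem_ae_iff.2 (measure_singleton (0 : V))] with ξ hξ
  by_cases hξk : ξ ∈ Metric.closedBall (0 : V) k
  · rw [norm_mul, Complex.norm_real, Real.norm_of_nonneg (Real.sqrt_nonneg _)]
    gcongr
    refine (hK ξ hξ).trans ?_
    gcongr
    · exact le_abs_self K
    · simpa using hξk
  · simp [hξk]

/-- The evolutions of the truncations of `f ∈ L²` converge in the weighted `L²` space. -/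
theorem exists_tendsto_evolution_indicator [Nontrivial V] {a : V → ℝ} (ha : Measurable a)
    {s K : ℝ} (hK : ∀ ξ ≠ 0, ‖gradient a ξ‖ ≤ K * ‖ξ‖) {C : ℝ≥0}
    (hC : ∀ h : V → ℂ, MemLp h 2 → Integrable (fun ξ => (√‖gradient a ξ‖ : ℂ) * h ξ) →
      eLpNorm (fun p : ℝ × V => (bracketWeight s p.2 : ℂ) * evolution a h p) 2
        ≤ C * eLpNorm h 2) {f : V → ℂ} (hf : MemLp f 2) :
    ∃ w : ℝ × V → ℂ, StronglyMeasurable w ∧ MemLp w 2 ∧ eLpNorm w 2 ≤ C * eLpNorm f 2 ∧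
      Tendsto (fun k : ℕ => eLpNorm ((fun p : ℝ × V => (bracketWeight s p.2 : ℂ) *
        evolution a ((Metric.closedBall (0 : V) k).indicator f) p) - w) 2) atTop (𝓝 0) := by
  set h : ℕ → V → ℂ := fun k => (Metric.closedBall (0 : V) k).indicator f with hh
  have hB : ∀ k : ℕ, MeasurableSet (Metric.closedBall (0 : V) k) := fun k =>
    Metric.isClosed_closedBall.measurableSet
  have hh2 : ∀ k, MemLp (h k) 2 := fun k => hf.indicator (hB k)
  have hhi : ∀ k, Integrable (fun ξ => (√‖gradient a ξ‖ : ℂ) * h k ξ) := fun k =>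
    integrable_sqrt_norm_gradient_mul_indicator hK hf k
  have hδ := tendsto_eLpNorm_indicator_closedBall_sub hf
  set W : ℕ → ℝ × V → ℂ := fun k p => (bracketWeight s p.2 : ℂ) * evolution a (h k) p with hW
  have hWc : ∀ k, Continuous (W k) := fun k => by
    have h1 := continuous_evolution ha (hhi k)
    have h2 := continuous_bracketWeight (W := V) s
    fun_prop
  have hle : ∀ k, eLpNorm (W k) 2 ≤ C * eLpNorm f 2 := fun k =>
    (hC _ (hh2 k) (hhi k)).trans (by gcongr; exact eLpNorm_indicator_le f)
  have hWm : ∀ k, MemLp (W k) 2 := fun k => ⟨(hWc k).aestronglyMeasurable,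
    (hle k).trans_lt (ENNReal.mul_lt_top (by simp) hf.2)⟩
  -- By linearity the a priori estimate applies to `h k - h l`, which gives the Cauchy property.
  have hdiff : ∀ k l, eLpNorm (W k - W l) 2 ≤ C * (eLpNorm (h k - f) 2 + eLpNorm (h l - f) 2) := by
    intro k l
    have e1 : Integrable fun ξ => (√‖gradient a ξ‖ : ℂ) * (h k - h l) ξ := by
      refine ((hhi k).sub (hhi l)).congr (Eventually.of_forall fun ξ => ?_)
      simp only [Pi.sub_apply, mul_sub]
    have e2 : W k - W l = fun p => (bracketWeight s p.2 : ℂ) * evolution a (h k - h l) p := by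
      funext p
      have := evolution_add ha e1 (hhi l) p
      rw [sub_add_cancel] at this
      simp only [Pi.sub_apply, hW, this]
      ring
    rw [e2]
    refine (hC _ ((hh2 k).sub (hh2 l)) e1).trans ?_
    gcongr
    rw [show h k - h l = (h k - f) - (h l - f) by abel]
    exact eLpNorm_sub_le ((hh2 k).1.sub hf.1) ((hh2 l).1.sub hf.1) (by norm_num)
  have hCδ : Tendsto (fun k => C * eLpNorm (h k - f) 2) atTop (𝓝 0) := by
    simpa using ENNReal.Tendsto.const_mul hδ (Or.inr ENNReal.coe_ne_top)
  have hcau : CauchySeq fun k => (hWm k).toLp (W k) := by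
    rw [EMetric.cauchySeq_iff]
    intro ε hε
    have hε2 : 0 < ε / 2 := ENNReal.half_pos hε.ne'
    obtain ⟨N, hN⟩ := eventually_atTop.1 (hCδ.eventually_lt_const hε2)
    refine ⟨N, fun k hk l hl => ?_⟩
    rw [Lp.edist_toLp_toLp]
    refine (hdiff k l).trans_lt ?_
    rw [mul_add, ← ENNReal.add_halves ε]
    exact ENNReal.add_lt_add (hN k hk) (hN l hl)
  obtain ⟨w, hw⟩ := cauchySeq_tendsto_of_complete hcau
  have hwlim : Tendsto (fun k => eLpNorm (W k - ⇑w) 2) atTop (𝓝 0) := by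
    have := tendsto_iff_edist_tendsto_0.1 hw
    refine this.congr fun k => ?_
    conv_lhs => rw [← Lp.toLp_coeFn w (Lp.memLp w)]
    exact Lp.edist_toLp_toLp _ _ _ _
  have hws : StronglyMeasurable w := Lp.stronglyMeasurable w
  have hwle : eLpNorm w 2 ≤ C * eLpNorm f 2 := by
    rw [← Lp.enorm_def]
    refine le_of_tendsto' hw.enorm fun k => ?_
    rw [Lp.enorm_toLp]
    exact hle k
  exact ⟨w, hws, Lp.memLp w, hwle, hwlim⟩

/-- Almost all slices of a square integrable function are square integrable. -/
theorem ae_memLp_slice {α β : Type*} [MeasurableSpace α] [MeasurableSpace β] {μ : Measure α}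
    {ν : Measure β} [SFinite μ] [SFinite ν] {w : α × β → ℂ} (hws : StronglyMeasurable w)
    (hw : MemLp w 2 (μ.prod ν)) : ∀ᵐ t ∂μ, MemLp (fun x => w (t, x)) 2 ν := by
  have h1 : ∫⁻ t, ∫⁻ x, ‖w (t, x)‖ₑ ^ 2 ∂ν ∂μ ≠ ⊤ := by
    rw [← lintegral_prod (fun p => ‖w p‖ₑ ^ 2) (hws.measurable.enorm.pow_const 2).aemeasurable,
      ← eLpNorm_two_sq]
    exact ENNReal.pow_ne_top hw.2.ne
  filter_upwards [ae_lt_top (hws.measurable.enorm.pow_const 2).lintegral_prod_right' h1] with t ht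
  refine ⟨(hws.comp_measurable measurable_prodMk_left).aestronglyMeasurable, ?_⟩
  rw [← eLpNorm_two_sq] at ht
  exact lt_top_iff_ne_top.2 fun h0 => by simp [h0] at ht

/-- Passing to the limit in an identity between pairings of square integrable functions. -/
theorem integral_mul_eq_of_frequently {α β : Type*} [MeasurableSpace α] [MeasurableSpace β]
    {μ : Measure α} {ν : Measure β} {W : ℕ → α → ℂ} {v P : α → ℂ} {h : ℕ → β → ℂ} {f Q : β → ℂ}
    (hW : ∀ k, MemLp (W k) 2 μ) (hv : MemLp v 2 μ) (hP : MemLp P 2 μ) (hh : ∀ k, MemLp (h k) 2 ν)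
    (hf : MemLp f 2 ν) (hQ : MemLp Q 2 ν)
    (hk : ∀ k, ∫ x, W k x * P x ∂μ = ∫ ξ, h k ξ * Q ξ ∂ν)
    (hfreq : ∀ ε : ℝ≥0∞, 0 < ε → ∃ᶠ k in atTop, eLpNorm (W k - v) 2 μ < ε)
    (hδ : Tendsto (fun k => eLpNorm (h k - f) 2 ν) atTop (𝓝 0)) :
    ∫ x, v x * P x ∂μ = ∫ ξ, f ξ * Q ξ ∂ν := by
  have hbound : ∀ k, ‖(∫ x, v x * P x ∂μ) - ∫ ξ, f ξ * Q ξ ∂ν‖ₑ ≤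
      eLpNorm (W k - v) 2 μ * eLpNorm P 2 μ + eLpNorm (h k - f) 2 ν * eLpNorm Q 2 ν := by
    intro k
    have i1 : Integrable (fun ξ => h k ξ * Q ξ) ν := (hh k).integrable_mul hQ
    have i2 : Integrable (fun ξ => f ξ * Q ξ) ν := hf.integrable_mul hQ
    have i3 : Integrable (fun x => v x * P x) μ := hv.integrable_mul hP
    have i4 : Integrable (fun x => W k x * P x) μ := (hW k).integrable_mul hP
    have e1 : (∫ x, v x * P x ∂μ) - ∫ ξ, f ξ * Q ξ ∂ν =
        (∫ ξ, (h k - f) ξ * Q ξ ∂ν) - ∫ x, (W k - v) x * P x ∂μ := by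
      simp only [Pi.sub_apply, sub_mul]
      rw [integral_sub i1 i2, integral_sub i4 i3, hk k]
      ring
    rw [e1, add_comm]
    exact enorm_sub_le.trans (add_le_add
      (enorm_integral_mul_le ((hh k).1.sub hf.1) hQ.1)
      (enorm_integral_mul_le ((hW k).1.sub hv.1) hP.1))
  rw [← sub_eq_zero, ← enorm_eq_zero]
  refine le_antisymm (le_of_forall_pos_le_add fun ε hε => ?_) zero_le
  have hB0 : Tendsto (fun k => eLpNorm (h k - f) 2 ν * eLpNorm Q 2 ν) atTop (𝓝 0) := by
    simpa using ENNReal.Tendsto.mul_const hδ (Or.inr hQ.2.ne)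
  have hε2 : 0 < ε / 2 := ENNReal.half_pos hε.ne'
  -- Adding `1` avoids a division by zero when `P` vanishes.
  have hP1 : eLpNorm P 2 μ + 1 ≠ ⊤ := by simpa using hP.2.ne
  obtain ⟨k, hk1, hk2⟩ := ((hfreq (ε / 2 / (eLpNorm P 2 μ + 1))
    (ENNReal.div_pos hε2.ne' hP1)).and_eventually (hB0.eventually_lt_const hε2)).exists
  refine (hbound k).trans ?_
  rw [zero_add, ← ENNReal.add_halves ε]
  refine add_le_add ?_ hk2.le
  calc eLpNorm (W k - v) 2 μ * eLpNorm P 2 μ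
      ≤ ε / 2 / (eLpNorm P 2 μ + 1) * (eLpNorm P 2 μ + 1) := by
        gcongr
        exact le_self_add
    _ = ε / 2 := ENNReal.div_mul_cancel (by simp) hP1

/-- The evolution is, for each time, the image under the multiplier. -/
theorem integral_evolution_mul {a : V → ℝ} (ha : Measurable a) {h : V → ℂ}
    (hh : Integrable (fun ξ => (√‖gradient a ξ‖ : ℂ) * h ξ)) (t : ℝ) (ψ : 𝓢(V, ℂ)) :
    ∫ x, evolution a h (t, x) * ψ x =
      ∫ ξ, Real.fourierChar (t * a ξ) • ((√‖gradient a ξ‖ : ℂ) * h ξ) * (𝓕⁻ ψ) ξ := by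
  rw [SchwartzMap.fourierInv_coe]
  exact integral_fourierInv_mul_eq (integrable_fourierChar_smul (ha.const_mul t) hh) ψ.integrable

/-- A limit point of the slices at time `t` of the evolutions of the truncations of `f` is the
image of `f` under the multiplier. -/
theorem integral_slice_mul_eq [Nontrivial V] {a : V → ℝ} (ha : Measurable a) {s K : ℝ}
    (hK : ∀ ξ ≠ 0, ‖gradient a ξ‖ ≤ K * ‖ξ‖) {f : V → ℂ} (hf : MemLp f 2) {t : ℝ} {v : V → ℂ}
    (hv : MemLp v 2)
    (hW : ∀ k : ℕ, MemLp (fun x => (bracketWeight s x : ℂ) *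
      evolution a ((Metric.closedBall (0 : V) k).indicator f) (t, x)) 2)
    (hfreq : ∀ ε : ℝ≥0∞, 0 < ε → ∃ᶠ k : ℕ in atTop,
      eLpNorm ((fun x => (bracketWeight s x : ℂ) *
        evolution a ((Metric.closedBall (0 : V) k).indicator f) (t, x)) - v) 2 < ε)
    (ψ : 𝓢(V, ℂ)) :
    Integrable (fun x => (bracketWeight s x : ℂ)⁻¹ * v x * ψ x) ∧
    Integrable (fun ξ => Real.fourierChar (t * a ξ) • (√‖gradient a ξ‖ : ℂ) * f ξ * (𝓕⁻ ψ) ξ) ∧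
    ∫ x, (bracketWeight s x : ℂ)⁻¹ * v x * ψ x =
      ∫ ξ, Real.fourierChar (t * a ξ) • (√‖gradient a ξ‖ : ℂ) * f ξ * (𝓕⁻ ψ) ξ := by
  have hP := memLp_bracketWeight_inv_mul s ψ
  have hQ := memLp_sqrt_norm_gradient_mul hK (𝓕⁻ ψ)
  -- The whole symbol is moved onto `𝓕⁻ ψ`, so that `f` is paired with an `L²` function.
  set Q : V → ℂ := fun ξ =>
    Real.fourierChar (t * a ξ) • ((√‖gradient a ξ‖ : ℂ) * (𝓕⁻ ψ) ξ) with hQdef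
  have hQ2 : MemLp Q 2 := by
    have hc : Measurable fun ξ => ((Real.fourierChar (t * a ξ) : Circle) : ℂ) :=
      (continuous_subtype_val.comp Real.continuous_fourierChar).measurable.comp (ha.const_mul t)
    refine hQ.of_le ?_ (Eventually.of_forall fun ξ => (Circle.norm_smul _ _).le)
    exact hc.aestronglyMeasurable.smul hQ.1
  have hsm : ∀ (c : Circle) (z : ℂ), c • z = (c : ℂ) * z := fun c z => rfl
  have eP : (fun x => (bracketWeight s x : ℂ)⁻¹ * v x * ψ x) =
      fun x => v x * ((bracketWeight s x : ℂ)⁻¹ * ψ x) := funext fun x => by ring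
  have eQ : (fun ξ => Real.fourierChar (t * a ξ) • (√‖gradient a ξ‖ : ℂ) * f ξ * (𝓕⁻ ψ) ξ) =
      fun ξ => f ξ * Q ξ := funext fun ξ => by
    simp only [hQdef, hsm]
    ring
  rw [eP, eQ]
  refine ⟨hv.integrable_mul hP, hf.integrable_mul hQ2, ?_⟩
  refine integral_mul_eq_of_frequently hW hv hP
    (fun k => hf.indicator Metric.isClosed_closedBall.measurableSet) hf hQ2 (fun k => ?_) hfreq
    (tendsto_eLpNorm_indicator_closedBall_sub hf)
  have h1 := integral_evolution_mul ha (integrable_sqrt_norm_gradient_mul_indicator hK hf k) t ψ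
  refine Eq.trans (integral_congr_ae (Eventually.of_forall fun x => ?_))
    (h1.trans (integral_congr_ae (Eventually.of_forall fun ξ => ?_)))
  · have := Complex.ofReal_ne_zero.2 (bracketWeight_pos s x).ne'
    field_simp
  · simp only [hQdef, hsm]
    ring

/-- The extension of the smoothing estimate to all of `L²`. -/
theorem exists_evolution_of_memLp [Nontrivial V] {a : V → ℝ} (ha : Measurable a) {s K : ℝ}
    (hK : ∀ ξ ≠ 0, ‖gradient a ξ‖ ≤ K * ‖ξ‖) {C : ℝ≥0}
    (hC : ∀ h : V → ℂ, MemLp h 2 → Integrable (fun ξ => (√‖gradient a ξ‖ : ℂ) * h ξ) →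
      eLpNorm (fun p : ℝ × V => (bracketWeight s p.2 : ℂ) * evolution a h p) 2
        ≤ C * eLpNorm h 2) {f : V → ℂ} (hf : MemLp f 2) :
    ∃ u : ℝ × V → ℂ, AEStronglyMeasurable u volume ∧
      (∀ᵐ t : ℝ, ∀ ψ : 𝓢(V, ℂ), Integrable (fun x => u (t, x) * ψ x) ∧
        Integrable (fun ξ => Real.fourierChar (t * a ξ) • (√‖gradient a ξ‖ : ℂ) * f ξ * (𝓕⁻ ψ) ξ) ∧
        ∫ x, u (t, x) * ψ x =
          ∫ ξ, Real.fourierChar (t * a ξ) • (√‖gradient a ξ‖ : ℂ) * f ξ * (𝓕⁻ ψ) ξ) ∧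
      eLpNorm (fun p : ℝ × V => (bracketWeight s p.2 : ℂ) * u p) 2 ≤ C * eLpNorm f 2 := by
  obtain ⟨w, hws, hw2, hwle, hwlim⟩ := exists_tendsto_evolution_indicator ha hK hC hf
  have hc := continuous_bracketWeight (W := V) s
  have hwt : Continuous fun p : ℝ × V => ((bracketWeight s p.2 : ℂ)⁻¹ : ℂ) :=
    Continuous.inv₀ (by fun_prop) fun p =>
      Complex.ofReal_ne_zero.2 (bracketWeight_pos s p.2).ne'
  refine ⟨fun p => (bracketWeight s p.2 : ℂ)⁻¹ * w p,
    hwt.aestronglyMeasurable.mul hws.aestronglyMeasurable, ?_, ?_⟩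
  · have hm : ∀ k : ℕ, StronglyMeasurable ((fun p : ℝ × V => (bracketWeight s p.2 : ℂ) *
        evolution a ((Metric.closedBall (0 : V) k).indicator f) p) - w) := fun k => by
      have h1 := continuous_evolution ha (integrable_sqrt_norm_gradient_mul_indicator hK hf k)
      exact StronglyMeasurable.sub (Continuous.stronglyMeasurable (by fun_prop)) hws
    have hWs : ∀ᵐ t : ℝ, ∀ k : ℕ, MemLp (fun x => (bracketWeight s x : ℂ) *
        evolution a ((Metric.closedBall (0 : V) k).indicator f) (t, x)) 2 := by
      refine ae_all_iff.2 fun k => ?_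
      have hi := integrable_sqrt_norm_gradient_mul_indicator hK hf k
      have h1 := continuous_evolution ha hi
      have h2 := hf.indicator (Metric.isClosed_closedBall (x := (0 : V)) (ε := k)).measurableSet
      refine ae_memLp_slice (w := fun p : ℝ × V => (bracketWeight s p.2 : ℂ) *
        evolution a ((Metric.closedBall (0 : V) k).indicator f) p)
        (Continuous.stronglyMeasurable (by fun_prop))
        ⟨Continuous.aestronglyMeasurable (by fun_prop), ?_⟩
      exact (hC _ h2 hi).trans_lt (ENNReal.mul_lt_top (by simp) h2.2)
    rw [Measure.volume_eq_prod] at hw2 hwlim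
    filter_upwards [ae_memLp_slice hws hw2, hWs, ae_frequently_eLpNorm_slice_lt hm hwlim]
      with t ht hWt hfreq ψ
    exact integral_slice_mul_eq ha hK hf ht hWt hfreq ψ
  · refine le_of_eq_of_le (congrArg (eLpNorm · 2 volume) (funext fun p => ?_)) hwle
    rw [mul_inv_cancel_left₀ (Complex.ofReal_ne_zero.2 (bracketWeight_pos s p.2).ne')]

end Extension
end

noncomputable section

/-! ### Normalization of the symbol, and the conclusion -/

section Symbol

variable {V : Type*} [NormedAddCommGroup V] [InnerProductSpace ℝ V] [FiniteDimensional ℝ V]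

/-- The gradient of a homogeneous function of degree two grows at most linearly. -/
theorem exists_norm_gradient_le {a : V → ℝ} (ha : ContDiffOn ℝ ∞ a {0}ᶜ)
    (hhom : ∀ l : ℝ, 0 < l → ∀ ξ : V, ξ ≠ 0 → a (l • ξ) = l ^ 2 * a ξ) :
    ∃ K : ℝ, ∀ ξ ≠ 0, ‖gradient a ξ‖ ≤ K * ‖ξ‖ := by
  have hcont : ContinuousOn (fderiv ℝ a) (Metric.sphere 0 1) := fun ξ hξ => by
    have h0 : ξ ≠ 0 := ne_zero_of_mem_unit_sphere (⟨ξ, hξ⟩ : Metric.sphere (0 : V) 1)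
    have h1 : ContDiffAt ℝ ∞ a ξ := ha.contDiffAt (isOpen_compl_singleton.mem_nhds h0)
    have h2 : ContDiffAt ℝ ∞ (fderiv ℝ a) ξ := h1.fderiv_right (by simp)
    exact h2.continuousAt.continuousWithinAt
  obtain ⟨K, hK⟩ := (isCompact_sphere (0 : V) 1).exists_bound_of_continuousOn hcont
  refine ⟨K, fun ξ hξ => ?_⟩
  have hpos : 0 < ‖ξ‖⁻¹ := by positivity
  have h := fderiv_smul_of_homogeneous (f := a) (l := ‖ξ‖⁻¹) (c := ‖ξ‖⁻¹) hpos.ne'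
    (fun η hη => by rw [hhom _ hpos η hη, smul_eq_mul, sq]) hξ
  have h1 := hK (‖ξ‖⁻¹ • ξ) (by simp [norm_smul, hξ])
  rw [h, norm_smul, norm_inv, norm_norm, inv_mul_le_iff₀ (norm_pos_iff.2 hξ)] at h1
  rw [norm_gradient, mul_comm]
  exact h1

theorem gradient_const_mul (c : ℝ) (a : V → ℝ) (ξ : V) :
    gradient (fun η => c * a η) ξ = c • gradient a ξ := by
  have h : fderiv ℝ (fun η => c * a η) ξ = c • fderiv ℝ a ξ :=
    congrFun (fderiv_const_smul_field (𝕜 := ℝ) (f := a) c) ξ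
  simp [gradient, h]

end Symbol

theorem measurable_of_contDiffOn_compl_zero {V : Type*} [NormedAddCommGroup V] [NormedSpace ℝ V]
    [MeasurableSpace V] [BorelSpace V] {a : V → ℝ} (ha : ContDiffOn ℝ ∞ a {0}ᶜ) : Measurable a :=
  measurable_of_continuousOn_compl_singleton 0 ha.continuousOn

theorem hessianMatrix_apply {n : ℕ} {a : EuclideanSpace ℝ (Fin n) → ℝ}
    {ξ : EuclideanSpace ℝ (Fin n)} (h : DifferentiableAt ℝ (fderiv ℝ a) ξ) (i j : Fin n) :
    hessianMatrix a ξ i j = fderiv ℝ (fderiv ℝ a) ξ (EuclideanSpace.single i 1)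
      (EuclideanSpace.single j 1) := by
  have h1 : HasFDerivAt (fun η => fderiv ℝ a η (EuclideanSpace.single j 1))
      ((ContinuousLinearMap.apply ℝ ℝ (EuclideanSpace.single j (1 : ℝ))).comp
        (fderiv ℝ (fderiv ℝ a) ξ)) ξ :=
    (ContinuousLinearMap.apply ℝ ℝ (EuclideanSpace.single j (1 : ℝ))).hasFDerivAt.comp ξ
      h.hasFDerivAt
  rw [hessianMatrix, Matrix.of_apply, h1.fderiv]
  rfl

theorem japaneseBracket_rpow_neg {n : ℕ} (s : ℝ) (x : EuclideanSpace ℝ (Fin n)) :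
    japaneseBracket x ^ (-s) = bracketWeight s x := by
  rw [japaneseBracket, bracketWeight, Real.sqrt_eq_rpow, ← Real.rpow_mul (by positivity)]
  ring_nf

/-- Replacing `a` by `2πa` absorbs the normalization: `a (2πξ) = 2π · (2πa) ξ` accounts for the `2π`
in the Fourier character, and `∇a (2πξ) = ∇(2πa) ξ`. -/
theorem invariantSymbol_two_pi_smul {n : ℕ} {a : EuclideanSpace ℝ (Fin n) → ℝ}
    (hhom : ∀ l : ℝ, 0 < l → ∀ ξ : EuclideanSpace ℝ (Fin n), ξ ≠ 0 → a (l • ξ) = l ^ 2 * a ξ)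
    (t : ℝ) {ξ : EuclideanSpace ℝ (Fin n)} (hξ : ξ ≠ 0) :
    invariantSymbol a t ((2 * Real.pi) • ξ) =
      Real.fourierChar (t * (2 * Real.pi * a ξ)) •
        (√‖gradient (fun η => 2 * Real.pi * a η) ξ‖ : ℂ) := by
  have hpi : 0 < 2 * Real.pi := by positivity
  have h := fderiv_smul_of_homogeneous (f := a) (l := 2 * Real.pi) (c := 2 * Real.pi) hpi.ne'
    (fun η hη => by rw [hhom _ hpi η hη, smul_eq_mul, sq]) hξ
  have hg : gradient a ((2 * Real.pi) • ξ) = (2 * Real.pi) • gradient a ξ := by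
    simp [gradient, h]
  rw [invariantSymbol, gradient_const_mul, hg, hhom _ hpi ξ hξ, ← Real.sqrt_eq_rpow,
    Circle.smul_def, Real.fourierChar_apply, smul_eq_mul, mul_comm]
  congr 2
  push_cast
  ring
end

theorem theorem6p6 (n : ℕ) (hn : 2 ≤ n) (s : ℝ) (hs : 1 / 2 < s)
    (a : EuclideanSpace ℝ (Fin n) → ℝ)
    (ha : ContDiffOn ℝ ∞ a {0}ᶜ)
    (hhom : ∀ l : ℝ, 0 < l → ∀ ξ : EuclideanSpace ℝ (Fin n), ξ ≠ 0 → a (l • ξ) = l ^ 2 * a ξ)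
    (hrank : ∀ ξ : EuclideanSpace ℝ (Fin n), ξ ≠ 0 → gradient a ξ = 0 →
      (hessianMatrix a ξ).rank = n - 1) :
    ∃ C : ℝ≥0, InvariantEstimate a s C := by
  have hpi : (2 * Real.pi) ≠ 0 := by positivity
  have : Nonempty (Fin n) := ⟨⟨0, by omega⟩⟩
  have : Nontrivial (EuclideanSpace ℝ (Fin n)) := inferInstance
  set b : EuclideanSpace ℝ (Fin n) → ℝ := fun ξ => 2 * Real.pi * a ξ with hb
  have hbc : ContDiffOn ℝ ∞ b {0}ᶜ := contDiffOn_const.mul ha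
  have hbm : Measurable b := measurable_of_contDiffOn_compl_zero hbc
  have hbhom : ∀ l : ℝ, 0 < l → ∀ ξ : EuclideanSpace ℝ (Fin n), ξ ≠ 0 →
      b (l • ξ) = l ^ 2 * b ξ := fun l hl ξ hξ => by
    simp only [hb, hhom l hl ξ hξ]
    ring
  have hfb : fderiv ℝ b = (2 * Real.pi) • fderiv ℝ a :=
    fderiv_const_smul_field (𝕜 := ℝ) (f := a) (2 * Real.pi)
  -- Only the nonvanishing of the Hessian at critical points is needed; it follows from `n - 1 ≥ 1`.
  have hbhess : ∀ ξ : EuclideanSpace ℝ (Fin n), ξ ≠ 0 → fderiv ℝ b ξ = 0 →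
      fderiv ℝ (fderiv ℝ b) ξ ≠ 0 := by
    intro ξ hξ h0 h2
    rw [hfb, Pi.smul_apply, smul_eq_zero_iff_right hpi] at h0
    have hf2 : fderiv ℝ ((2 * Real.pi) • fderiv ℝ a) ξ = (2 * Real.pi) • fderiv ℝ (fderiv ℝ a) ξ :=
      congrFun (fderiv_const_smul_field (𝕜 := ℝ) (f := fderiv ℝ a) (2 * Real.pi)) ξ
    rw [hfb, hf2, smul_eq_zero_iff_right hpi] at h2
    have hA : ContDiffAt ℝ ∞ a ξ := ha.contDiffAt (isOpen_compl_singleton.mem_nhds hξ)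
    have hA1 : ContDiffAt ℝ ∞ (fderiv ℝ a) ξ := hA.fderiv_right (by simp)
    have hM : hessianMatrix a ξ = 0 := by
      ext i j
      rw [hessianMatrix_apply (hA1.differentiableAt (by simp)), h2]
      rfl
    have hr := hrank ξ hξ (by simp [gradient, h0])
    rw [hM, Matrix.rank_zero] at hr
    omega
  obtain ⟨C, hC⟩ := exists_eLpNorm_evolution_le hbm hbc hbhom hbhess hs
  obtain ⟨K, hK⟩ := exists_norm_gradient_le hbc hbhom
  refine ⟨C, fun φ => ?_⟩
  obtain ⟨u, hu, hslice, hle⟩ := exists_evolution_of_memLp hbm hK hC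
    (Lp.memLp (𝓕 φ : Lp (α := EuclideanSpace ℝ (Fin n)) ℂ 2 volume))
  refine ⟨u, hu, hslice.mono fun t ht ψ => ?_, ?_⟩
  · obtain ⟨h1, h2, h3⟩ := ht ψ
    have hae : (fun ξ => Real.fourierChar (t * b ξ) • (√‖gradient b ξ‖ : ℂ) *
        (𝓕 φ : Lp (α := EuclideanSpace ℝ (Fin n)) ℂ 2 volume) ξ * (𝓕⁻ ψ) ξ) =ᵐ[volume]
        fun ξ => invariantSymbol a t ((2 * Real.pi) • ξ) *
          (𝓕 φ : Lp (α := EuclideanSpace ℝ (Fin n)) ℂ 2 volume) ξ * (𝓕⁻ ψ) ξ := by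
      filter_upwards [compl_mem_ae_iff.2
        (measure_singleton (0 : EuclideanSpace ℝ (Fin n)))] with ξ hξ
      rw [invariantSymbol_two_pi_smul hhom t hξ]
    exact ⟨h1, h2.congr hae, h3.trans (integral_congr_ae hae)⟩
  · simp only [japaneseBracket_rpow_neg]
    refine hle.trans_eq ?_
    rw [← Lp.enorm_def, ← ofReal_norm, Lp.norm_fourier_eq, ofReal_norm]
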